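/- **Setting.** Let $z=(t,x)=(t,x^1,x^2,x^3)\in\mathbb R\times\mathbb R^3$ and $u=(u^1,\dots,u^m)$. A *differential function* $f[u]$ is a smooth function, defined on the whole jet space, of $(t,x)$ and of finitely many of the jet coordinates $u^\alpha_I$ (standing for $\partial^I u^\alpha$, $I$ a multi-index in $t,x^1,x^2,x^3$). Total derivatives are $D_i=\partial_{z^i}+\sum_{\alpha,I}u^\alpha_{I+e_i}\,\partial_{u^\alpha_I}$, and $\operatorname{Curl}\vec\Theta=\vec D_x\times\vec\Theta$ is formed with the spatial total derivatives $\vec D_x=(D_1,D_2,D_3)$. Let $G^a[u]=0$, $a=1,\dots,M$, be a PDE system given by differential functions $G^a$. For differential functions $f,g$ write $f|_{\mathcal E}=g|_{\mathcal E}$ if $f[u](z)=g[u](z)$ for every smooth solution $u$ of the system on an open set of space-time and every point $z$ of that set; for vectors this is meant componentwise. A *closed regular surface* is a compact connected oriented piecewise smooth surface $S\subset\mathbb R^3$ without boundary: a connected topological surface that is cut into finitely many smooth patches, each parametrized by the unit square, injective and immersive in its interior and non-overlapping, such that each edge of a patch is either collapsed to a point or glued to exactly one other edge, traversed in the opposite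 direction. A vector differential function $\vec X[u]$ is the flux density of a *topological flux conservation law* of the system if $$\oint_S \vec X[u]\cdot d\vec S=0$$ for every time $t$, every solution $u$, and every closed regular surface $S$ bounding a volume that lies in the spatial domain of $u$ at time $t$. Such a law is called * *locally trivial* if there is a vector differential function $\vec\Theta[u]$ with $\vec X[u]|_{\mathcal E}=\operatorname{Curl}\vec\Theta[u]|_{\mathcal E}$; * *globally trivial for arbitrary closed regular surfaces* if it holds as a mere identity, that is, if there is a vector differential function $\vec Y[u]$ with $\vec X[u]|_{\mathcal E}=\vec Y[u]|_{\mathcal E}$ such that $\oint_S\vec Y[u]\cdot d\vec S=0$ for every time $t$, every closed regular surface $S\subset\mathbb R^3$, and every smooth function $u$ on $\mathbb R\times\mathbb R^3$, whether or not it solves the system. **Proposition.** A topological flux conservation law of a PDE system is globally trivial for arbitrary closed regular surfaces if and only if it is locally trivial. -/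

import Mathlib

open scoped ContDiff Matrix
open Set

noncomputable section

namespace TopFlux

/-! ### Jet space and differential functions

The independent variables are `z = (t, x¹, x², x³) : Fin 4 → ℝ` (index `0` is time), and the
dependent variables are `u = (u¹, …, uᵐ)`. -/

/-- The jet space with coordinates `(z, u^α_I)`: here `α : Fin m` labels the dependent variable and
the multi-index `I : Fin 4 → ℕ` records how often each independent variable is differentiated
(`I = 0` is `u^α` itself). -/
abbrev JetSpace (m : ℕ) : Type := (Fin 4 → ℝ) × (Fin m × (Fin 4 → ℕ) → ℝ)

/-- A differential function: a smooth function of `(t, x)` and of finitely many of the jet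
coordinates `u^α_I`. -/
def IsDifferentialFunction {m : ℕ} (f : JetSpace m → ℝ) : Prop :=
  ∃ (s : Finset (Fin m × (Fin 4 → ℕ))) (g : (Fin 4 → ℝ) × (s → ℝ) → ℝ),
    ContDiff ℝ ∞ g ∧ ∀ p : JetSpace m, f p = g (p.1, fun j => p.2 j)

/-- The total derivative `D_i = ∂/∂z^i + ∑_{α, I} u^α_{I + e_i} ∂/∂u^α_I`, that is, the derivative
along the vector field on jet space with the components `e_i` and `u^α_{I + e_i}`. -/
def totalDeriv {m : ℕ} (i : Fin 4) (f : JetSpace m → ℝ) : JetSpace m → ℝ := fun p =>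
  lineDeriv ℝ f p (Pi.single i 1, fun j => p.2 (j.1, j.2 + Pi.single i 1))

/-- The total curl `D_x × Θ` of a vector differential function `Θ = (Θ¹, Θ², Θ³)`; the spatial
variables carry the indices `1, 2, 3` among the independent variables. -/
def totalCurl {m : ℕ} (Θ : Fin 3 → JetSpace m → ℝ) : Fin 3 → JetSpace m → ℝ :=
  ![fun p => totalDeriv 2 (Θ 2) p - totalDeriv 3 (Θ 1) p,
    fun p => totalDeriv 3 (Θ 0) p - totalDeriv 1 (Θ 2) p,
    fun p => totalDeriv 1 (Θ 1) p - totalDeriv 2 (Θ 0) p]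

/-- The partial derivative `∂f/∂z^i` of a function of `z = (t, x)`. -/
def partialDeriv (i : Fin 4) (f : (Fin 4 → ℝ) → ℝ) : (Fin 4 → ℝ) → ℝ := fun z =>
  lineDeriv ℝ f z (Pi.single i 1)

/-- The iterated partial derivative `∂^I f` (for smooth `f` the order of differentiation is
irrelevant). -/
def iterPartialDeriv (I : Fin 4 → ℕ) (f : (Fin 4 → ℝ) → ℝ) : (Fin 4 → ℝ) → ℝ :=
  (partialDeriv 0)^[I 0] ((partialDeriv 1)^[I 1] ((partialDeriv 2)^[I 2]
    ((partialDeriv 3)^[I 3] f)))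

/-- The point of jet space given by the values at `z` of `u` and all its partial derivatives, so
that `f[u](z)` is `f (jet u z)` for a differential function `f`. -/
def jet {m : ℕ} (u : (Fin 4 → ℝ) → Fin m → ℝ) (z : Fin 4 → ℝ) : JetSpace m :=
  (z, fun j => iterPartialDeriv j.2 (fun y => u y j.1) z)

/-! ### PDE systems and their solutions -/

/-- `u` is a smooth solution of the system `G¹[u] = 0, …, Gᴹ[u] = 0` on the set `U` of space-time
(used for open `U`). -/
def IsSolutionOn {m M : ℕ} (G : Fin M → JetSpace m → ℝ) (U : Set (Fin 4 → ℝ))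
    (u : (Fin 4 → ℝ) → Fin m → ℝ) : Prop :=
  ContDiffOn ℝ ∞ u U ∧ ∀ z ∈ U, ∀ a, G a (jet u z) = 0

/-- `f|_𝓔 = g|_𝓔`: the two functions agree on the solution space of the system, that is,
`f[u](z) = g[u](z)` for every solution `u` on an open set of space-time and every point `z` of this
set. -/
def EqOnSolutions {m M : ℕ} (G : Fin M → JetSpace m → ℝ) (f g : JetSpace m → ℝ) : Prop :=
  ∀ (U : Set (Fin 4 → ℝ)) (u : (Fin 4 → ℝ) → Fin m → ℝ), IsOpen U → IsSolutionOn G U u →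
    ∀ z ∈ U, f (jet u z) = g (jet u z)

/-! ### Closed regular surfaces and flux integrals -/

/-- The closed unit square, the parameter domain of a patch. -/
def closedSquare : Set (ℝ × ℝ) := Icc 0 1 ×ˢ Icc 0 1

/-- The open unit square. -/
def openSquare : Set (ℝ × ℝ) := Ioo 0 1 ×ˢ Ioo 0 1

/-- The four edges of the unit square, run through counterclockwise for `s ∈ [0, 1]`. -/
def squareEdge (j : Fin 4) (s : ℝ) : ℝ × ℝ :=
  ![((s, 0) : ℝ × ℝ), (1, s), (1 - s, 1), (0, 1 - s)] j

/-- The normal vector `∂₁φ × ∂₂φ` of a parametrized patch. -/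
def patchNormal (φ : ℝ × ℝ → Fin 3 → ℝ) (p : ℝ × ℝ) : Fin 3 → ℝ :=
  (fderiv ℝ φ p (1, 0)) ⨯₃ (fderiv ℝ φ p (0, 1))

/-- The point set covered by finitely many patches. -/
def patchUnion {n : ℕ} (patch : Fin n → ℝ × ℝ → Fin 3 → ℝ) : Set (Fin 3 → ℝ) :=
  ⋃ k, patch k '' closedSquare

/-- A closed regular surface in `ℝ³`: connected, without boundary, piecewise smooth, oriented.

It is a compact connected topological surface in `ℝ³`, cut into finitely many smooth patches
parametrized by the unit square. The patches are injective and immersive inside the square and do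
not overlap. Every edge of a patch is either collapsed to a point (as at the poles of spherical
coordinates or at the tip of a cone), or is glued to exactly one other edge; glued edges are
traversed in opposite directions by the counterclockwise boundaries, so that the normals
`∂₁φ × ∂₂φ` of the patches orient the surface and no boundary is left. -/
structure ClosedSurface where
  /-- the number of patches -/
  n : ℕ
  /-- the patches -/
  patch : Fin n → ℝ × ℝ → Fin 3 → ℝ
  smooth : ∀ k, ContDiff ℝ ∞ (patch k)
  inj : ∀ k l, ∀ p ∈ openSquare, ∀ q ∈ closedSquare, patch k p = patch l q → k = l ∧ p = q
  immersive : ∀ k, ∀ p ∈ openSquare, patchNormal (patch k) p ≠ 0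
  /-- the pairing of the edges; its values on collapsed edges are irrelevant -/
  glue : Fin n × Fin 4 → Fin n × Fin 4
  edges : ∀ e : Fin n × Fin 4,
    (∃ c, ∀ s ∈ Icc (0 : ℝ) 1, patch e.1 (squareEdge e.2 s) = c) ∨
    (glue e ≠ e ∧ glue (glue e) = e ∧ ∀ s ∈ Icc (0 : ℝ) 1,
      patch (glue e).1 (squareEdge (glue e).2 s) = patch e.1 (squareEdge e.2 (1 - s)))
  connected : IsConnected (patchUnion patch)
  manifold : Nonempty (ChartedSpace (EuclideanSpace ℝ (Fin 2)) (patchUnion patch))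

/-- The surface as a subset of `ℝ³`. -/
def ClosedSurface.carrier (S : ClosedSurface) : Set (Fin 3 → ℝ) := patchUnion S.patch

/-- The volume bounded by a closed surface: the surface together with all bounded components of its
complement. -/
def ClosedSurface.enclosed (S : ClosedSurface) : Set (Fin 3 → ℝ) :=
  S.carrier ∪ {x | x ∉ S.carrier ∧ Bornology.IsBounded (connectedComponentIn S.carrierᶜ x)}

/-- The flux `∮_S F · dS` of a vector field through a closed surface. -/
def ClosedSurface.flux (S : ClosedSurface) (F : (Fin 3 → ℝ) → Fin 3 → ℝ) : ℝ :=
  ∑ k, ∫ p in closedSquare, F (S.patch k p) ⬝ᵥ patchNormal (S.patch k) p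

/-- The vector field `x ↦ X[u](t, x)` at a fixed time `t`. -/
def fieldAt {m : ℕ} (X : Fin 3 → JetSpace m → ℝ) (u : (Fin 4 → ℝ) → Fin m → ℝ) (t : ℝ) :
    (Fin 3 → ℝ) → Fin 3 → ℝ :=
  fun x i => X i (jet u (Fin.cons t x))

/-! ### Topological flux conservation laws and their triviality -/

/-- `X` is the flux density of a topological flux conservation law of the system `G`: for every
solution `u` and every time, `∮_S X[u] · dS = 0` on every closed regular surface `S` bounding a
volume that lies in the spatial domain of the solution. -/
def IsTopologicalFluxLaw {m M : ℕ} (G : Fin M → JetSpace m → ℝ) (X : Fin 3 → JetSpace m → ℝ) :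
    Prop :=
  ∀ (U : Set (Fin 4 → ℝ)) (u : (Fin 4 → ℝ) → Fin m → ℝ), IsOpen U → IsSolutionOn G U u →
    ∀ (t : ℝ) (S : ClosedSurface),
      (∀ x ∈ S.enclosed, (Fin.cons t x : Fin 4 → ℝ) ∈ U) → S.flux (fieldAt X u t) = 0

/-- Local triviality: `X|_𝓔 = (Curl Θ)|_𝓔` for some vector differential function `Θ`. -/
def LocallyTrivial {m M : ℕ} (G : Fin M → JetSpace m → ℝ) (X : Fin 3 → JetSpace m → ℝ) : Prop :=
  ∃ Θ : Fin 3 → JetSpace m → ℝ, (∀ i, IsDifferentialFunction (Θ i)) ∧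
    ∀ i, EqOnSolutions G (X i) (totalCurl Θ i)

/-- Global triviality on arbitrary closed regular surfaces: the law holds as a mere identity, which
carries no information about the solutions. That is, on solutions `X` coincides with a vector
differential function `Y` whose flux through every closed regular surface vanishes at all times for
arbitrary smooth functions `u(t, x)`, solutions of the system or not. -/
def GloballyTrivial {m M : ℕ} (G : Fin M → JetSpace m → ℝ) (X : Fin 3 → JetSpace m → ℝ) : Prop :=
  ∃ Y : Fin 3 → JetSpace m → ℝ, (∀ i, IsDifferentialFunction (Y i)) ∧
    (∀ i, EqOnSolutions G (X i) (Y i)) ∧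
    ∀ u : (Fin 4 → ℝ) → Fin m → ℝ, ContDiff ℝ ∞ u →
      ∀ (t : ℝ) (S : ClosedSurface), S.flux (fieldAt Y u t) = 0

end TopFlux

end

open scoped ContDiff Matrix
open Set

noncomputable section

namespace TopFlux

/-! Both notions of triviality replace `X` by a vector differential function with the same values on
solutions, so the matter is one about differential functions alone: `Y` has vanishing flux through
every closed regular surface for every smooth `u` if and only if `Y = Curl Θ` identically on jet
space.

A curl has no flux: Stokes' theorem on each patch (`integral_curl_patch`) turns the flux into line
integrals along the edges of all patches; collapsed edges contribute nothing and glued edges cancel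
in pairs (`ClosedSurface.flux_curl`).

Conversely, the flux through a sphere of radius `r`, divided by `r ^ 2`, is smooth in `r` up to `r =
0`, and its derivative there is a multiple of the divergence at the centre
(`sum_fderiv_eq_zero_of_flux_eq_zero`). Thus `Div Y` vanishes along every jet of a smooth function.
As finitely many jet coordinates at a point can be prescribed, `Div Y = 0` on all of jet space. It
remains to see that the total divergence is exact (`exists_totalD_curl`).

This is shown by linearization. The forms `∑ (∂f/∂u_J) δu_J` inherit the total derivatives, and with
respect to `D_i` a form splits into a part free of derivatives in the variable `i` and a part `D_i
β`, while `D_i η` is free of them only for `η = 0`. Removing the variables one at a time gives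
exactness for forms (`exists_form_curl`). Integration along the segments to the zero section
(`homotopyOp`) commutes with total derivatives and recovers `f` from its linearization up to its
restriction to the zero section; that restriction is handled by the Poincaré lemma on space-time
(`exists_curl_of_div_eq_zero`). -/

open MeasureTheory Topology Metric

/-! ### Smooth dependence of integrals on parameters. -/

section ParametricIntegral

variable {H Y : Type*} [NormedAddCommGroup H] [NormedSpace ℝ H] [ProperSpace H]
  [NormedAddCommGroup Y] [NormedSpace ℝ Y] [MeasurableSpace Y] [BorelSpace Y]

/-- Differentiation under an integral over a compact set. -/
theorem hasFDerivAt_setIntegral {E : Type*} [NormedAddCommGroup E] [NormedSpace ℝ E]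
    {μ : Measure Y} [IsFiniteMeasureOnCompacts μ] {K : Set Y} (hK : IsCompact K)
    {g : H × Y → E} (hg : ContDiff ℝ 1 g) (x₀ : H) :
    HasFDerivAt (fun x => ∫ y in K, g (x, y) ∂μ)
      (∫ y in K, (fderiv ℝ g (x₀, y)).comp (ContinuousLinearMap.inl ℝ H Y) ∂μ) x₀ := by
  have hcont : Continuous fun p : H × Y =>
      (fderiv ℝ g p).comp (ContinuousLinearMap.inl ℝ H Y) :=
    (hg.continuous_fderiv one_ne_zero).clm_comp continuous_const
  obtain ⟨C, hC⟩ := ((isCompact_closedBall x₀ 1).prod hK).exists_bound_of_continuousOn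
    hcont.continuousOn
  have hmeas : MeasurableSet K := hK.measurableSet
  have hpair : ∀ x : H, Continuous fun y : Y => (x, y) := fun x => by fun_prop
  refine hasFDerivAt_integral_of_dominated_of_fderiv_le (𝕜 := ℝ) (bound := fun _ => C)
    (F := fun x y => g (x, y))
    (F' := fun x y => (fderiv ℝ g (x, y)).comp (ContinuousLinearMap.inl ℝ H Y))
    (closedBall_mem_nhds x₀ one_pos) ?_ ?_ ?_ ?_ ?_ ?_
  · exact Filter.Eventually.of_forall fun x =>
      ((hg.continuous.comp (hpair x)).continuousOn.integrableOn_compact hK).aestronglyMeasurable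
  · exact (hg.continuous.comp (hpair x₀)).continuousOn.integrableOn_compact hK
  · exact ((hcont.comp (hpair x₀)).continuousOn.integrableOn_compact hK).aestronglyMeasurable
  · filter_upwards [ae_restrict_mem hmeas] with y hy x hx using hC (x, y) ⟨hx, hy⟩
  · exact (continuousOn_const (c := C)).integrableOn_compact hK
  · refine Filter.Eventually.of_forall fun y x _ => ?_
    exact ((hg.differentiable one_ne_zero (x, y)).hasFDerivAt).comp x
      ((hasFDerivAt_id x).prodMk (hasFDerivAt_const y x))

/-- The derivative is an integral of the same kind with values in `H →L[ℝ] E`. The induction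
therefore runs over all target spaces at once, which forces them into one universe. -/
theorem contDiff_nat_setIntegral {H Y : Type} [NormedAddCommGroup H] [NormedSpace ℝ H]
    [ProperSpace H] [NormedAddCommGroup Y] [NormedSpace ℝ Y] [MeasurableSpace Y] [BorelSpace Y]
    {μ : Measure Y} [IsFiniteMeasureOnCompacts μ] {K : Set Y} (hK : IsCompact K) (n : ℕ) :
    ∀ {E : Type} [NormedAddCommGroup E] [NormedSpace ℝ E] {g : H × Y → E},
      ContDiff ℝ ∞ g → ContDiff ℝ n fun x => ∫ y in K, g (x, y) ∂μ := by
  induction n with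
  | zero =>
    intro E _ _ g hg
    exact contDiff_zero.2 (Differentiable.continuous (𝕜 := ℝ) fun x =>
      (hasFDerivAt_setIntegral hK (hg.of_le (mod_cast le_top)) x).differentiableAt)
  | succ n ih =>
    intro E _ _ g hg
    have hd := fun x => hasFDerivAt_setIntegral (μ := μ) hK (hg.of_le (mod_cast le_top)) x
    push_cast
    refine contDiff_succ_iff_fderiv.2 ⟨fun x => (hd x).differentiableAt, by simp, ?_⟩
    rw [show fderiv ℝ (fun x => ∫ y in K, g (x, y) ∂μ) = _ from funext fun x => (hd x).fderiv]
    exact ih (g := fun p => (fderiv ℝ g p).comp (ContinuousLinearMap.inl ℝ H Y))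
      ((hg.fderiv_right (m := ∞) (by simp)).clm_comp contDiff_const)

/-- An integral over a compact set of a smooth function depends smoothly on parameters. -/
theorem contDiff_setIntegral {H Y : Type} [NormedAddCommGroup H] [NormedSpace ℝ H]
    [ProperSpace H] [NormedAddCommGroup Y] [NormedSpace ℝ Y] [MeasurableSpace Y] [BorelSpace Y]
    {μ : Measure Y} [IsFiniteMeasureOnCompacts μ] {K : Set Y} (hK : IsCompact K)
    {E : Type} [NormedAddCommGroup E] [NormedSpace ℝ E] {g : H × Y → E} (hg : ContDiff ℝ ∞ g) :
    ContDiff ℝ ∞ fun x => ∫ y in K, g (x, y) ∂μ :=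
  contDiff_infty.2 fun n => contDiff_nat_setIntegral hK n hg

/-- Directional differentiation under an integral over a compact set. -/
theorem fderiv_setIntegral_apply {E : Type*} [NormedAddCommGroup E] [NormedSpace ℝ E]
    {μ : Measure Y} [IsFiniteMeasureOnCompacts μ] {K : Set Y} (hK : IsCompact K)
    {g : H × Y → E} (hg : ContDiff ℝ 1 g) (x v : H) :
    fderiv ℝ (fun x => ∫ y in K, g (x, y) ∂μ) x v =
      ∫ y in K, fderiv ℝ g (x, y) (v, 0) ∂μ := by
  rw [(hasFDerivAt_setIntegral hK hg x).fderiv, ContinuousLinearMap.integral_apply]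
  · simp
  · have hcont : Continuous fun y : Y =>
        (fderiv ℝ g (x, y)).comp (ContinuousLinearMap.inl ℝ H Y) :=
      ((hg.continuous_fderiv one_ne_zero).comp (by fun_prop)).clm_comp continuous_const
    exact hcont.continuousOn.integrableOn_compact hK

end ParametricIntegral

variable {m : ℕ}

/-! ### The algebra of differential functions -/

/-- The projection of the jet space onto finitely many coordinates. -/
def jetRestrict (s : Finset (Fin m × (Fin 4 → ℕ))) :
    JetSpace m →ₗ[ℝ] (Fin 4 → ℝ) × (s → ℝ) :=
  LinearMap.prodMap LinearMap.id (LinearMap.funLeft ℝ ℝ Subtype.val)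

theorem IsDifferentialFunction.of_jetRestrict {f : JetSpace m → ℝ}
    {s : Finset (Fin m × (Fin 4 → ℕ))} {g : (Fin 4 → ℝ) × (s → ℝ) → ℝ} (hg : ContDiff ℝ ∞ g)
    (h : ∀ p, f p = g (jetRestrict s p)) : IsDifferentialFunction f :=
  ⟨s, g, hg, h⟩

theorem IsDifferentialFunction.exists_jetRestrict {f : JetSpace m → ℝ}
    (hf : IsDifferentialFunction f) :
    ∃ (s : Finset (Fin m × (Fin 4 → ℕ))) (g : (Fin 4 → ℝ) × (s → ℝ) → ℝ),
      ContDiff ℝ ∞ g ∧ f = g ∘ jetRestrict s := by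
  obtain ⟨s, g, hg, h⟩ := hf
  exact ⟨s, g, hg, funext h⟩

theorem contDiff_extend_jetRestrict {s t : Finset (Fin m × (Fin 4 → ℕ))} (hst : s ⊆ t)
    {g : (Fin 4 → ℝ) × (s → ℝ) → ℝ} (hg : ContDiff ℝ ∞ g) :
    ContDiff ℝ ∞ fun q : (Fin 4 → ℝ) × (t → ℝ) => g (q.1, fun j => q.2 ⟨j, hst j.2⟩) :=
  hg.comp (by fun_prop)

/-- A function of the coordinates and of two differential functions. -/
theorem IsDifferentialFunction.comp₂ {f₁ f₂ : JetSpace m → ℝ} (h₁ : IsDifferentialFunction f₁)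
    (h₂ : IsDifferentialFunction f₂) {φ : ℝ × ℝ → ℝ} (hφ : ContDiff ℝ ∞ φ) :
    IsDifferentialFunction fun p => φ (f₁ p, f₂ p) := by
  classical
  obtain ⟨s₁, g₁, hg₁, e₁⟩ := h₁
  obtain ⟨s₂, g₂, hg₂, e₂⟩ := h₂
  refine ⟨s₁ ∪ s₂, fun q => φ (g₁ (q.1, fun j => q.2 ⟨j, Finset.subset_union_left j.2⟩),
    g₂ (q.1, fun j => q.2 ⟨j, Finset.subset_union_right j.2⟩)), ?_, fun p => by simp only [e₁, e₂]⟩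
  exact hφ.comp ((contDiff_extend_jetRestrict _ hg₁).prodMk (contDiff_extend_jetRestrict _ hg₂))

theorem isDifferentialFunction_comp_fst {h : (Fin 4 → ℝ) → ℝ} (hh : ContDiff ℝ ∞ h) :
    IsDifferentialFunction fun p : JetSpace m => h p.1 :=
  ⟨∅, fun q => h q.1, hh.comp contDiff_fst, fun _ => rfl⟩

theorem isDifferentialFunction_coord (j : Fin m × (Fin 4 → ℕ)) :
    IsDifferentialFunction fun p : JetSpace m => p.2 j :=
  ⟨{j}, fun q => q.2 ⟨j, Finset.mem_singleton_self j⟩, by fun_prop, fun _ => rfl⟩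

/-- The differential functions as a subalgebra of all functions on jet space. -/
def diffAlg (m : ℕ) : Subalgebra ℝ (JetSpace m → ℝ) where
  carrier := {f | IsDifferentialFunction f}
  mul_mem' h₁ h₂ := h₁.comp₂ h₂ (φ := fun q => q.1 * q.2) (contDiff_fst.mul contDiff_snd)
  add_mem' h₁ h₂ := h₁.comp₂ h₂ (φ := fun q => q.1 + q.2) (contDiff_fst.add contDiff_snd)
  algebraMap_mem' c := isDifferentialFunction_comp_fst (h := fun _ => c) contDiff_const

/-- The differential functions as a vector space. -/
def diffFun (m : ℕ) : Submodule ℝ (JetSpace m → ℝ) where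
  carrier := {f | IsDifferentialFunction f}
  add_mem' h₁ h₂ := (diffAlg m).add_mem h₁ h₂
  zero_mem' := (diffAlg m).zero_mem
  smul_mem' c _ h := Subalgebra.smul_mem (diffAlg m) h c

/-- The type of differential functions. -/
def DiffFun (m : ℕ) : Type := diffFun m

instance : AddCommGroup (DiffFun m) := inferInstanceAs (AddCommGroup (diffFun m))

instance : Module ℝ (DiffFun m) := inferInstanceAs (Module ℝ (diffFun m))

/-- Evaluation of differential functions, as a linear map. -/
def DiffFun.toFun : DiffFun m →ₗ[ℝ] (JetSpace m → ℝ) := (diffFun m).subtype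

instance : CoeFun (DiffFun m) fun _ => JetSpace m → ℝ := ⟨fun f => DiffFun.toFun f⟩

theorem DiffFun.isDifferentialFunction (f : DiffFun m) : IsDifferentialFunction f := f.2

/-- A function with the property of being a differential function. -/
def DiffFun.mk (f : JetSpace m → ℝ) (hf : IsDifferentialFunction f) : DiffFun m := ⟨f, hf⟩

@[simp] theorem DiffFun.add_apply (f g : DiffFun m) (p : JetSpace m) : (f + g) p = f p + g p := rfl

@[simp] theorem DiffFun.sub_apply (f g : DiffFun m) (p : JetSpace m) : (f - g) p = f p - g p := rfl

@[ext] theorem DiffFun.ext {f g : DiffFun m} (h : ∀ p, f p = g p) : f = g :=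
  Subtype.ext (funext h)

/-! ### Derivatives along vector fields on jet space -/

/-- Jet space is a product over infinitely many coordinates, so only line derivatives are taken
there; through the linear projection they become Fréchet derivatives in finite dimensions. -/
theorem hasLineDerivAt_comp_jetRestrict {s : Finset (Fin m × (Fin 4 → ℕ))}
    {g : (Fin 4 → ℝ) × (s → ℝ) → ℝ} {p v : JetSpace m}
    (hg : DifferentiableAt ℝ g (jetRestrict s p)) :
    HasLineDerivAt ℝ (g ∘ jetRestrict s) (fderiv ℝ g (jetRestrict s p) (jetRestrict s v)) p v := by
  have := hg.hasFDerivAt.hasLineDerivAt (jetRestrict s v)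
  simpa [HasLineDerivAt, Function.comp_def, map_add, map_smul] using this

theorem lineDeriv_comp_jetRestrict {s : Finset (Fin m × (Fin 4 → ℕ))}
    {g : (Fin 4 → ℝ) × (s → ℝ) → ℝ} (hg : ContDiff ℝ ∞ g) (p v : JetSpace m) :
    lineDeriv ℝ (g ∘ jetRestrict s) p v = fderiv ℝ g (jetRestrict s p) (jetRestrict s v) :=
  (hasLineDerivAt_comp_jetRestrict (hg.differentiable (by simp) _)).lineDeriv

theorem IsDifferentialFunction.lineDifferentiableAt {f : JetSpace m → ℝ}
    (hf : IsDifferentialFunction f) (p v : JetSpace m) : LineDifferentiableAt ℝ f p v := by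
  obtain ⟨s, g, hg, rfl⟩ := hf.exists_jetRestrict
  exact (hasLineDerivAt_comp_jetRestrict (hg.differentiable (by simp) _)).lineDifferentiableAt

theorem lineDeriv_add_apply {f g : JetSpace m → ℝ} (hf : IsDifferentialFunction f)
    (hg : IsDifferentialFunction g) (p v : JetSpace m) :
    lineDeriv ℝ (f + g) p v = lineDeriv ℝ f p v + lineDeriv ℝ g p v :=
  (HasDerivAt.add (hf.lineDifferentiableAt p v).hasLineDerivAt
    (hg.lineDifferentiableAt p v).hasLineDerivAt).deriv

theorem lineDeriv_mul_apply {f g : JetSpace m → ℝ} (hf : IsDifferentialFunction f)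
    (hg : IsDifferentialFunction g) (p v : JetSpace m) :
    lineDeriv ℝ (f * g) p v = lineDeriv ℝ f p v * g p + f p * lineDeriv ℝ g p v := by
  have h := HasDerivAt.mul (hf.lineDifferentiableAt p v).hasLineDerivAt
    (hg.lineDifferentiableAt p v).hasLineDerivAt
  rw [zero_smul, add_zero] at h
  exact HasDerivAt.deriv h

theorem lineDeriv_smul_apply {f : JetSpace m → ℝ} (hf : IsDifferentialFunction f) (c : ℝ)
    (p v : JetSpace m) : lineDeriv ℝ (c • f) p v = c * lineDeriv ℝ f p v :=
  (HasDerivAt.const_smul c (hf.lineDifferentiableAt p v).hasLineDerivAt).deriv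

/-- A vector field on jet space all components of which are differential functions. -/
structure IsDifferentialField (V : JetSpace m → JetSpace m) : Prop where
  fst : ∀ i, IsDifferentialFunction fun p => (V p).1 i
  snd : ∀ j, IsDifferentialFunction fun p => (V p).2 j

/-- By the chain rule only the components of `V` in the finitely many coordinates on which `f`
depends matter, so the derivative is a finite sum of products of differential functions. -/
theorem IsDifferentialFunction.lineDeriv {f : JetSpace m → ℝ} (hf : IsDifferentialFunction f)
    {V : JetSpace m → JetSpace m} (hV : IsDifferentialField V) :
    IsDifferentialFunction fun p => lineDeriv ℝ f p (V p) := by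
  classical
  obtain ⟨s, g, hg, rfl⟩ := hf.exists_jetRestrict
  have hc : ∀ w, (fun p => fderiv ℝ g (jetRestrict s p) w) ∈ diffAlg m := fun w =>
    IsDifferentialFunction.of_jetRestrict
      ((hg.fderiv_right (m := ∞) (by simp)).clm_apply contDiff_const) fun _ => rfl
  have key : (fun p => _root_.lineDeriv ℝ (g ∘ jetRestrict s) p (V p)) =
      (∑ i, (fun p => (V p).1 i) * fun p => fderiv ℝ g (jetRestrict s p) (Pi.single i 1, 0)) +
      ∑ j : s, (fun p => (V p).2 j) * fun p => fderiv ℝ g (jetRestrict s p) (0, Pi.single j 1) := by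
    funext p
    rw [lineDeriv_comp_jetRestrict hg]
    have : jetRestrict s (V p) = (∑ i, (V p).1 i • ((Pi.single i 1, 0) : (Fin 4 → ℝ) × (s → ℝ))) +
        ∑ j : s, (V p).2 j • ((0, Pi.single j 1) : (Fin 4 → ℝ) × (s → ℝ)) := by
      ext k
      · simp [jetRestrict, Prod.fst_sum, Finset.sum_apply, Pi.single_apply]
      · simp [jetRestrict, Prod.snd_sum, Finset.sum_apply, Pi.single_apply, LinearMap.funLeft]
    rw [this]
    simp only [map_add, map_sum, map_smul, Pi.add_apply, Finset.sum_apply, Pi.mul_apply,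
      smul_eq_mul]
  rw [key]
  change _ ∈ diffAlg m
  exact add_mem (sum_mem fun i _ => mul_mem (hV.fst i) (hc _))
    (sum_mem fun j _ => mul_mem (hV.snd j) (hc _))

/-- Differentiation along a vector field as a linear operator on differential functions. -/
def fieldDeriv (V : JetSpace m → JetSpace m) (hV : IsDifferentialField V) :
    DiffFun m →ₗ[ℝ] DiffFun m where
  toFun f := .mk (fun p => lineDeriv ℝ f p (V p)) (f.isDifferentialFunction.lineDeriv hV)
  map_add' f g := DiffFun.ext fun p =>
    lineDeriv_add_apply f.isDifferentialFunction g.isDifferentialFunction p (V p)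
  map_smul' c f := DiffFun.ext fun p => lineDeriv_smul_apply f.isDifferentialFunction c p (V p)

theorem fieldDeriv_apply {V : JetSpace m → JetSpace m} (hV : IsDifferentialField V)
    (f : DiffFun m) (p : JetSpace m) : fieldDeriv V hV f p = lineDeriv ℝ f p (V p) := rfl

/-- Here `a + t • b` is the moving base point and `c + t • d` the value there of an affine vector
field. -/
theorem hasDerivAt_fderiv_affine {E : Type*} [NormedAddCommGroup E] [NormedSpace ℝ E] {g : E → ℝ}
    (hg : ContDiff ℝ ∞ g) (a b c d : E) :
    HasDerivAt (fun t : ℝ => fderiv ℝ g (a + t • b) (c + t • d))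
      (fderiv ℝ (fderiv ℝ g) a b c + fderiv ℝ g a d) 0 := by
  have h (a b : E) : HasDerivAt (fun t : ℝ => a + t • b) b 0 := by
    simpa using ((hasDerivAt_id (0 : ℝ)).smul_const b).const_add a
  have hd : HasFDerivAt (fderiv ℝ g) (fderiv ℝ (fderiv ℝ g) a) (a + (0 : ℝ) • b) := by
    rw [zero_smul, add_zero]
    exact ((hg.fderiv_right (m := ∞) (by simp)).differentiable (by simp) a).hasFDerivAt
  have h1 : HasDerivAt (fun t : ℝ => fderiv ℝ g (a + t • b)) (fderiv ℝ (fderiv ℝ g) a b) 0 :=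
    hd.comp_hasDerivAt (0 : ℝ) (h a b)
  have h2 := h1.clm_apply (h c d)
  rw [zero_smul, zero_smul, add_zero, add_zero] at h2
  exact h2

/-- The second derivative along an affine field `V` and a vector `w`, where `L` is the linear
part of `V` applied to `w`. -/
theorem lineDeriv_lineDeriv_comp_jetRestrict {s : Finset (Fin m × (Fin 4 → ℕ))}
    {g : (Fin 4 → ℝ) × (s → ℝ) → ℝ} (hg : ContDiff ℝ ∞ g) {V : JetSpace m → JetSpace m}
    {p w L : JetSpace m} (hV : ∀ t : ℝ, V (p + t • w) = V p + t • L) :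
    lineDeriv ℝ (fun q => lineDeriv ℝ (g ∘ jetRestrict s) q (V q)) p w =
      fderiv ℝ (fderiv ℝ g) (jetRestrict s p) (jetRestrict s w) (jetRestrict s (V p)) +
        fderiv ℝ g (jetRestrict s p) (jetRestrict s L) := by
  rw [lineDeriv, ← (hasDerivAt_fderiv_affine hg (jetRestrict s p) (jetRestrict s w)
    (jetRestrict s (V p)) (jetRestrict s L)).deriv]
  congr 1
  funext t
  rw [lineDeriv_comp_jetRestrict hg, hV, map_add, map_add, map_smul, map_smul]

theorem two_le_infty : (2 : WithTop ℕ∞) ≤ ∞ := WithTop.coe_le_coe.2 le_top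

/-- Derivatives along affine fields commute up to the derivative along the Lie bracket. -/
theorem lineDeriv_lineDeriv_sub {f : JetSpace m → ℝ} (hf : IsDifferentialFunction f)
    {V W : JetSpace m → JetSpace m} {p K L : JetSpace m}
    (hV : ∀ t : ℝ, V (p + t • W p) = V p + t • L) (hW : ∀ t : ℝ, W (p + t • V p) = W p + t • K) :
    lineDeriv ℝ (fun q => lineDeriv ℝ f q (V q)) p (W p) + lineDeriv ℝ f p K =
      lineDeriv ℝ (fun q => lineDeriv ℝ f q (W q)) p (V p) + lineDeriv ℝ f p L := by
  obtain ⟨s, g, hg, rfl⟩ := hf.exists_jetRestrict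
  -- The second-order terms agree by symmetry of the second derivative; only the terms with `K` and
  -- `L` differ.
  rw [lineDeriv_lineDeriv_comp_jetRestrict hg hV, lineDeriv_lineDeriv_comp_jetRestrict hg hW,
    lineDeriv_comp_jetRestrict hg, lineDeriv_comp_jetRestrict hg,
    ((hg.contDiffAt).isSymmSndFDerivAt (by simpa using two_le_infty)).eq (jetRestrict s (W p)) (jetRestrict s (V p))]
  ring

/-! ### Total and vertical derivatives -/

/-- Raising the multi-index of a jet coordinate by one differentiation. -/
def jetShift (i : Fin 4) (J : Fin m × (Fin 4 → ℕ)) : Fin m × (Fin 4 → ℕ) :=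
  (J.1, J.2 + Pi.single i 1)

theorem jetShift_injective (i : Fin 4) : Function.Injective (jetShift (m := m) i) := by
  rintro ⟨a, I⟩ ⟨b, J⟩ h
  simpa [jetShift] using h

theorem jetShift_comm (i j : Fin 4) (J : Fin m × (Fin 4 → ℕ)) :
    jetShift i (jetShift j J) = jetShift j (jetShift i J) := by
  simp [jetShift, add_right_comm]

theorem jetShift_snd_self (i : Fin 4) (J : Fin m × (Fin 4 → ℕ)) :
    (jetShift i J).2 i = J.2 i + 1 := by
  simp [jetShift]

theorem jetShift_snd_of_ne {i j : Fin 4} (h : i ≠ j) (J : Fin m × (Fin 4 → ℕ)) :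
    (jetShift j J).2 i = J.2 i := by
  simp [jetShift, h]

theorem exists_jetShift_eq {i : Fin 4} {J : Fin m × (Fin 4 → ℕ)} (h : J.2 i ≠ 0) :
    ∃ K, jetShift i K = J := by
  refine ⟨(J.1, J.2 - Pi.single i 1), Prod.ext rfl (funext fun k => ?_)⟩
  rcases eq_or_ne k i with rfl | hk
  · simp [jetShift]; omega
  · simp [jetShift, hk]

/-- The vector field on jet space whose directional derivative is the total derivative. -/
def totalField (i : Fin 4) (p : JetSpace m) : JetSpace m :=
  (Pi.single i 1, fun J => p.2 (jetShift i J))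

theorem isDifferentialField_totalField (i : Fin 4) :
    IsDifferentialField (totalField (m := m) i) where
  fst _ := isDifferentialFunction_comp_fst contDiff_const
  snd J := isDifferentialFunction_coord (jetShift i J)

theorem isDifferentialField_const (v : JetSpace m) : IsDifferentialField fun _ => v where
  fst _ := isDifferentialFunction_comp_fst contDiff_const
  snd _ := isDifferentialFunction_comp_fst contDiff_const

/-- The total derivative as an operator on differential functions. -/
def totalD (i : Fin 4) : DiffFun m →ₗ[ℝ] DiffFun m :=
  fieldDeriv (totalField i) (isDifferentialField_totalField i)

/-- The derivative in the direction of a jet coordinate, as an operator on differential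
functions. -/
def vertD (J : Fin m × (Fin 4 → ℕ)) : DiffFun m →ₗ[ℝ] DiffFun m :=
  fieldDeriv (fun _ => (0, Pi.single J 1)) (isDifferentialField_const _)

theorem totalField_add_smul (i : Fin 4) (p w : JetSpace m) (t : ℝ) :
    totalField i (p + t • w) = totalField i p + t • (0, fun J => w.2 (jetShift i J)) := by
  ext <;> simp [totalField]

/-- The Lie bracket of two total fields vanishes because the index shifts commute. -/
theorem totalD_comm (i j : Fin 4) (f : DiffFun m) :
    totalD i (totalD j f) = totalD j (totalD i f) := by
  refine DiffFun.ext fun p => ?_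
  have h := lineDeriv_lineDeriv_sub f.isDifferentialFunction (V := totalField j) (W := totalField i) (p := p)
    (fun t => totalField_add_smul j p _ t) (fun t => totalField_add_smul i p _ t)
  have hK : (fun J => (totalField j p).2 (jetShift i J)) =
      fun J => (totalField i p).2 (jetShift j J) := by
    funext J
    simp [totalField, jetShift_comm i j]
  rw [hK] at h
  exact add_right_cancel h

/-- The extra term is the derivative along the bracket of `∂/∂u_J` with `D_i`: this is `∂/∂u_{J -
e_i}` if `J` contains a derivative in the variable `i`, and zero otherwise. -/
theorem vertD_totalD (i : Fin 4) (J : Fin m × (Fin 4 → ℕ)) (f : DiffFun m) (p : JetSpace m) :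
    vertD J (totalD i f) p = totalD i (vertD J f) p +
      lineDeriv ℝ f p (0, fun K => (Pi.single J 1 : Fin m × (Fin 4 → ℕ) → ℝ) (jetShift i K)) := by
  have h := lineDeriv_lineDeriv_sub f.isDifferentialFunction (V := totalField i) (W := fun _ => (0, Pi.single J 1))
    (p := p) (K := 0) (fun t => totalField_add_smul i p _ t) (fun t => by simp)
  rwa [lineDeriv_zero, add_zero] at h

theorem vertD_jetShift_totalD (i : Fin 4) (J : Fin m × (Fin 4 → ℕ)) (f : DiffFun m) :
    vertD (jetShift i J) (totalD i f) = totalD i (vertD (jetShift i J) f) + vertD J f := by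
  refine DiffFun.ext fun p => ?_
  have h : (fun K => (Pi.single (jetShift i J) 1 : Fin m × (Fin 4 → ℕ) → ℝ) (jetShift i K)) =
      Pi.single J 1 := by
    funext K
    simp [Pi.single_apply, (jetShift_injective i).eq_iff]
  rw [vertD_totalD, h]
  rfl

theorem vertD_totalD_of_eq_zero {i : Fin 4} {J : Fin m × (Fin 4 → ℕ)} (hJ : J.2 i = 0)
    (f : DiffFun m) : vertD J (totalD i f) = totalD i (vertD J f) := by
  refine DiffFun.ext fun p => ?_
  have h : (fun K => (Pi.single J 1 : Fin m × (Fin 4 → ℕ) → ℝ) (jetShift i K)) = 0 := by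
    funext K
    refine Pi.single_eq_of_ne ?_ _
    rintro rfl
    simp [jetShift_snd_self] at hJ
  rw [vertD_totalD, h, show ((0, 0) : JetSpace m) = 0 from rfl, lineDeriv_zero, add_zero]

/-! ### Linear forms in the variations of the jet coordinates -/

/-- Finite sums `∑ a_J δu_J` with differential functions as coefficients. -/
abbrev JetForm (m : ℕ) : Type := (Fin m × (Fin 4 → ℕ)) →₀ DiffFun m

/-- The total derivative of linear forms, `D_i (a δu_J) = (D_i a) δu_J + a δu_{J + e_i}`. -/
def formD (i : Fin 4) : JetForm m →ₗ[ℝ] JetForm m :=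
  Finsupp.mapRange.linearMap (totalD i) + Finsupp.lmapDomain (DiffFun m) ℝ (jetShift i)

theorem formD_single (i : Fin 4) (J : Fin m × (Fin 4 → ℕ)) (a : DiffFun m) :
    formD i (Finsupp.single J a) =
      Finsupp.single J (totalD i a) + Finsupp.single (jetShift i J) a := by
  simp [formD]

theorem formD_apply_jetShift (i : Fin 4) (ξ : JetForm m) (J : Fin m × (Fin 4 → ℕ)) :
    formD i ξ (jetShift i J) = totalD i (ξ (jetShift i J)) + ξ J := by
  simp [formD, Finsupp.mapDomain_apply (jetShift_injective i)]

theorem formD_apply_of_eq_zero {i : Fin 4} {J : Fin m × (Fin 4 → ℕ)} (hJ : J.2 i = 0)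
    (ξ : JetForm m) : formD i ξ J = totalD i (ξ J) := by
  have : J ∉ Set.range (jetShift (m := m) i) := by
    rintro ⟨K, rfl⟩
    simp [jetShift_snd_self] at hJ
  simp [formD, Finsupp.mapDomain_of_notMem_range _ _ this]

theorem formD_comm (i j : Fin 4) (ξ : JetForm m) :
    formD i (formD j ξ) = formD j (formD i ξ) := by
  induction ξ using Finsupp.induction_linear with
  | zero => simp
  | add ξ η h₁ h₂ => simp only [map_add, h₁, h₂]
  | single J a =>
    simp only [formD_single, map_add, totalD_comm i j, jetShift_comm i j]
    abel

/-- The forms without derivatives in the variable `i`. -/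
def reducedForms (m : ℕ) (i : Fin 4) : Submodule ℝ (JetForm m) :=
  Finsupp.supported (DiffFun m) ℝ {J | J.2 i = 0}

theorem mem_reducedForms {i : Fin 4} {ξ : JetForm m} :
    ξ ∈ reducedForms m i ↔ ∀ J, J.2 i ≠ 0 → ξ J = 0 := by
  rw [reducedForms, Finsupp.mem_supported']
  rfl

theorem single_mem_reducedForms {i : Fin 4} {J : Fin m × (Fin 4 → ℕ)} (hJ : J.2 i = 0)
    (a : DiffFun m) : Finsupp.single J a ∈ reducedForms m i :=
  Finsupp.single_mem_supported _ _ hJ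

/-- `D_j` raises only the order in the variable `j`. -/
theorem formD_mem_reducedForms {i j : Fin 4} (hij : i ≠ j) {ξ : JetForm m}
    (hξ : ξ ∈ reducedForms m i) : formD j ξ ∈ reducedForms m i := by
  rw [mem_reducedForms] at hξ ⊢
  intro J hJ
  by_cases hj : J.2 j = 0
  · rw [formD_apply_of_eq_zero hj, hξ J hJ, map_zero]
  · obtain ⟨K, rfl⟩ := exists_jetShift_eq hj
    rw [formD_apply_jetShift, hξ _ hJ, map_zero, zero_add]
    exact hξ K (by rwa [jetShift_snd_of_ne hij] at hJ)

/-- Integration by parts. -/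
theorem exists_reducedForm_add_formD (i : Fin 4) (ξ : JetForm m) :
    ∃ α ∈ reducedForms m i, ∃ β, ξ = α + formD i β := by
  induction ξ using Finsupp.induction_linear with
  | zero => exact ⟨0, zero_mem _, 0, by simp⟩
  | add ξ η h₁ h₂ =>
    obtain ⟨α, hα, β, rfl⟩ := h₁
    obtain ⟨α', hα', β', rfl⟩ := h₂
    exact ⟨α + α', add_mem hα hα', β + β', by rw [map_add]; abel⟩
  | single J a =>
    obtain ⟨n, hn⟩ : ∃ n, J.2 i = n := ⟨_, rfl⟩
    induction n generalizing J a with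
    | zero => exact ⟨_, single_mem_reducedForms hn a, 0, by simp⟩
    | succ n ih =>
      obtain ⟨K, rfl⟩ := exists_jetShift_eq (i := i) (J := J) (by omega)
      -- Use `a δu_{K + e_i} = D_i (a δu_K) - (D_i a) δu_K`; the last form has one derivative fewer
      -- in the variable `i`.
      obtain ⟨α, hα, β, h⟩ := ih K (totalD i a) (by rw [jetShift_snd_self] at hn; omega)
      refine ⟨-α, neg_mem hα, Finsupp.single K a - β, ?_⟩
      rw [map_sub, formD_single, h]
      abel

/-- If `η ≠ 0`, choose `J` in its support of maximal order in the variable `i`. The coefficient of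
`D_i η` at `J + e_i` is then exactly `η J ≠ 0`, and this index contains a derivative in `i`. -/
theorem eq_zero_of_formD_mem_reducedForms {i : Fin 4} {η : JetForm m}
    (h : formD i η ∈ reducedForms m i) : η = 0 := by
  by_contra hη
  obtain ⟨J, hJ, hmax⟩ := Finset.exists_max_image η.support (fun J => J.2 i)
    (Finsupp.support_nonempty_iff.2 hη)
  have h0 : η (jetShift i J) = 0 := by
    by_contra hne
    have := hmax _ (Finsupp.mem_support_iff.2 hne)
    rw [jetShift_snd_self] at this
    omega
  have h1 := mem_reducedForms.1 h (jetShift i J) (by rw [jetShift_snd_self]; omega)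
  rw [formD_apply_jetShift, h0, map_zero, zero_add] at h1
  exact Finsupp.mem_support_iff.1 hJ h1

/-- Three commuting operators for which one can integrate by parts have an exact divergence. -/
theorem exists_curl_of_integration_by_parts {M : Type*} [AddCommGroup M] [Module ℝ M]
    (D : Fin 4 → M →ₗ[ℝ] M) (R : Fin 4 → Submodule ℝ M)
    (hcomm : ∀ i j x, D i (D j x) = D j (D i x))
    (hmem : ∀ i j, i ≠ j → ∀ x ∈ R i, D j x ∈ R i)
    (hdiv : ∀ i x, ∃ a ∈ R i, ∃ b, x = a + D i b)
    (hinj : ∀ i x, D i x ∈ R i → x = 0) {x₁ x₂ x₃ : M} (h : D 1 x₁ + D 2 x₂ + D 3 x₃ = 0) :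
    ∃ θ₁ θ₂ θ₃ : M, x₁ = D 2 θ₃ - D 3 θ₂ ∧ x₂ = D 3 θ₁ - D 1 θ₃ ∧ x₃ = D 1 θ₂ - D 2 θ₁ := by
  -- Up to the curl of `(b₂, -b₁, 0)` the first two components may be taken in `R 3`. Then `D 3` of
  -- the corrected third component lies in `R 3`, so that component vanishes.
  obtain ⟨a₁, ha₁, b₁, rfl⟩ := hdiv 3 x₁
  obtain ⟨a₂, ha₂, b₂, rfl⟩ := hdiv 3 x₂
  simp only [map_add] at h
  rw [hcomm 1 3, hcomm 2 3] at h
  have h3 : D 3 (x₃ + D 1 b₁ + D 2 b₂) = -(D 1 a₁ + D 2 a₂) := by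
    simp only [map_add]
    rw [← sub_eq_zero, ← h]
    abel
  have h3' : x₃ + D 1 b₁ + D 2 b₂ = 0 := by
    refine hinj 3 _ ?_
    rw [h3]
    exact neg_mem (add_mem (hmem _ _ (by decide) _ ha₁) (hmem _ _ (by decide) _ ha₂))
  rw [h3', map_zero, eq_comm, neg_eq_zero] at h3
  -- What remains is `D 1 a₁ + D 2 a₂ = 0`; the same argument removes the variable `2`, and then
  -- `1`.
  obtain ⟨c, hc, d, rfl⟩ := hdiv 2 a₁
  rw [map_add, hcomm 1 2] at h3
  have h2 : D 2 (a₂ + D 1 d) = -D 1 c := by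
    rw [map_add, ← sub_eq_zero, ← h3]
    abel
  have h2' : a₂ + D 1 d = 0 := by
    refine hinj 2 _ ?_
    rw [h2]
    exact neg_mem (hmem _ _ (by decide) _ hc)
  rw [h2', map_zero, eq_comm, neg_eq_zero] at h2
  have h1 : c = 0 := hinj 1 c (by rw [h2]; exact zero_mem _)
  refine ⟨b₂, -b₁, d, ?_, ?_, ?_⟩
  · rw [h1, map_neg]; abel
  · rw [eq_neg_of_add_eq_zero_left h2']; abel
  · rw [map_neg, ← sub_eq_zero, ← h3']; abel

/-- Exactness of the total divergence on linear forms. -/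
theorem exists_form_curl {ξ₁ ξ₂ ξ₃ : JetForm m}
    (h : formD 1 ξ₁ + formD 2 ξ₂ + formD 3 ξ₃ = 0) :
    ∃ θ₁ θ₂ θ₃ : JetForm m, ξ₁ = formD 2 θ₃ - formD 3 θ₂ ∧ ξ₂ = formD 3 θ₁ - formD 1 θ₃ ∧
      ξ₃ = formD 1 θ₂ - formD 2 θ₁ :=
  exists_curl_of_integration_by_parts formD (reducedForms m) formD_comm
    (fun _ _ hij _ hx => formD_mem_reducedForms hij hx) exists_reducedForm_add_formD
    (fun _ _ hx => eq_zero_of_formD_mem_reducedForms hx) h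

theorem jetRestrict_single_of_notMem {s : Finset (Fin m × (Fin 4 → ℕ))}
    {J : Fin m × (Fin 4 → ℕ)} (hJ : J ∉ s) :
    jetRestrict s ((0, Pi.single J 1) : JetSpace m) = 0 := by
  ext k
  · simp [jetRestrict]
  · have : (k : Fin m × (Fin 4 → ℕ)) ≠ J := fun h => hJ (h ▸ k.2)
    simp [jetRestrict, LinearMap.funLeft, this]

/-- The linearization `∑ (∂f/∂u_J) δu_J` of a differential function. -/
theorem exists_linearization (f : DiffFun m) : ∃ ξ : JetForm m, ∀ J, ξ J = vertD J f := by
  classical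
  obtain ⟨f, hf⟩ := f
  obtain ⟨s, g, hg, rfl⟩ := hf.exists_jetRestrict
  refine ⟨Finsupp.onFinset s (fun J => vertD J ⟨_, hf⟩) fun J hJ => ?_, fun J => rfl⟩
  contrapose! hJ
  refine DiffFun.ext fun p => ?_
  exact (lineDeriv_comp_jetRestrict hg p _).trans
    (by rw [jetRestrict_single_of_notMem hJ, map_zero]; rfl)

/-- The linearization of a differential function. -/
def linearization (f : DiffFun m) : JetForm m := (exists_linearization f).choose

theorem linearization_apply (f : DiffFun m) (J : Fin m × (Fin 4 → ℕ)) :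
    linearization f J = vertD J f := (exists_linearization f).choose_spec J

theorem linearization_add (f g : DiffFun m) :
    linearization (f + g) = linearization f + linearization g := by
  ext1 J
  simp [linearization_apply]

/-- The two terms of `formD` are made for this: the shifted one is the commutator of `∂/∂u_J` with
`D_i`. -/
theorem linearization_totalD (i : Fin 4) (f : DiffFun m) :
    linearization (totalD i f) = formD i (linearization f) := by
  ext1 J
  by_cases hJ : J.2 i = 0
  · rw [linearization_apply, formD_apply_of_eq_zero hJ, linearization_apply,
      vertD_totalD_of_eq_zero hJ]
  · obtain ⟨K, rfl⟩ := exists_jetShift_eq hJ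
    rw [linearization_apply, formD_apply_jetShift, linearization_apply, linearization_apply,
      vertD_jetShift_totalD]

/-! ### Partial derivatives of smooth functions -/

theorem partialDeriv_apply_eq_fderiv {h : (Fin 4 → ℝ) → ℝ} {z : Fin 4 → ℝ}
    (hh : DifferentiableAt ℝ h z) (i : Fin 4) :
    partialDeriv i h z = fderiv ℝ h z (Pi.single i 1) :=
  hh.lineDeriv_eq_fderiv

theorem partialDeriv_eq_fderiv {h : (Fin 4 → ℝ) → ℝ} (hh : ContDiff ℝ ∞ h) (i : Fin 4) :
    partialDeriv i h = fun z => fderiv ℝ h z (Pi.single i 1) :=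
  funext fun z => partialDeriv_apply_eq_fderiv (hh.differentiable (by simp) z) i

theorem contDiff_partialDeriv {h : (Fin 4 → ℝ) → ℝ} (hh : ContDiff ℝ ∞ h) (i : Fin 4) :
    ContDiff ℝ ∞ (partialDeriv i h) := by
  rw [partialDeriv_eq_fderiv hh]
  exact (hh.fderiv_right (m := ∞) (by simp)).clm_apply contDiff_const

theorem partialDeriv_comm {h : (Fin 4 → ℝ) → ℝ} (hh : ContDiff ℝ ∞ h) (i j : Fin 4) :
    partialDeriv i (partialDeriv j h) = partialDeriv j (partialDeriv i h) := by
  have hd : Differentiable ℝ (fderiv ℝ h) :=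
    (hh.fderiv_right (m := ∞) (by simp)).differentiable (by simp)
  have key (i j : Fin 4) (z : Fin 4 → ℝ) : partialDeriv i (partialDeriv j h) z =
      fderiv ℝ (fderiv ℝ h) z (Pi.single i 1) (Pi.single j 1) := by
    rw [partialDeriv_eq_fderiv (contDiff_partialDeriv hh j), partialDeriv_eq_fderiv hh j]
    have h1 := ((hd z).hasFDerivAt.clm_apply
      (hasFDerivAt_const (Pi.single j 1 : Fin 4 → ℝ) z)).fderiv
    simp only [h1]
    simp
  funext z
  rw [key, key, (hh.contDiffAt.isSymmSndFDerivAt (by simpa using two_le_infty)).eq]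

theorem partialDeriv_add {f g : (Fin 4 → ℝ) → ℝ} (hf : ContDiff ℝ ∞ f) (hg : ContDiff ℝ ∞ g)
    (i : Fin 4) : partialDeriv i (f + g) = partialDeriv i f + partialDeriv i g :=
  funext fun z => (HasDerivAt.add
    ((hf.differentiable (by simp) z).lineDifferentiableAt (v := Pi.single i 1)).hasLineDerivAt
    ((hg.differentiable (by simp) z).lineDifferentiableAt (v := Pi.single i 1)).hasLineDerivAt).deriv

theorem apply_add_smul_of_partialDeriv_eq_zero {h : (Fin 4 → ℝ) → ℝ} (hh : ContDiff ℝ ∞ h)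
    {i : Fin 4} (h0 : partialDeriv i h = 0) (z : Fin 4 → ℝ) (t : ℝ) :
    h (z + t • Pi.single i 1) = h z := by
  have hline (s : ℝ) : HasDerivAt (fun t : ℝ => z + t • (Pi.single i 1 : Fin 4 → ℝ))
      (Pi.single i 1) s := by
    simpa using ((hasDerivAt_id s).smul_const (Pi.single i 1 : Fin 4 → ℝ)).const_add z
  have hd (s : ℝ) : HasDerivAt (fun t : ℝ => h (z + t • Pi.single i 1)) 0 s := by
    have := ((hh.differentiable (by simp) (z + s • Pi.single i 1)).hasFDerivAt).comp_hasDerivAt s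
      (hline s)
    rwa [← partialDeriv_apply_eq_fderiv (hh.differentiable (by simp) _), h0] at this
  have := is_const_of_deriv_eq_zero (fun s => (hd s).differentiableAt) (fun s => (hd s).deriv) t 0
  simpa using this

/-- A smooth primitive in the variable `i`. -/
theorem exists_partialDeriv_eq {h : (Fin 4 → ℝ) → ℝ} (hh : ContDiff ℝ ∞ h) (i : Fin 4) :
    ∃ H : (Fin 4 → ℝ) → ℝ, ContDiff ℝ ∞ H ∧ partialDeriv i H = h ∧
      ∀ j ≠ i, partialDeriv j h = 0 → partialDeriv j H = 0 := by
  have hupd : ContDiff ℝ ∞ fun q : (Fin 4 → ℝ) × ℝ => Function.update q.1 i q.2 := by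
    refine contDiff_pi.2 fun k => ?_
    simp only [Function.update_apply]
    split_ifs <;> fun_prop
  refine ⟨fun z => ∫ s in (0 : ℝ)..z i, h (Function.update z i s), ?_, ?_, ?_⟩
  -- The substitution `s = y * z i` makes the domain of integration independent of `z`, so that
  -- smooth dependence on parameters applies.
  · have hH : (fun z : Fin 4 → ℝ => ∫ s in (0 : ℝ)..z i, h (Function.update z i s)) =
        fun z => z i * ∫ y in Icc (0 : ℝ) 1, h (Function.update z i (y * z i)) := by
      funext z
      rw [integral_Icc_eq_integral_Ioc, ← intervalIntegral.integral_of_le zero_le_one,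
        intervalIntegral.mul_integral_comp_mul_right (f := fun s => h (Function.update z i s))]
      simp
    rw [hH]
    refine (contDiff_apply ℝ ℝ i).mul (contDiff_setIntegral isCompact_Icc
      (g := fun q : (Fin 4 → ℝ) × ℝ => h (Function.update q.1 i (q.2 * q.1 i))) ?_)
    exact hh.comp (hupd.comp (f := fun q : (Fin 4 → ℝ) × ℝ => (q.1, q.2 * q.1 i)) (by fun_prop))
  · funext z
    have hc : Continuous fun s : ℝ => h (Function.update z i s) :=
      (hh.comp (hupd.comp (f := fun s : ℝ => (z, s)) (by fun_prop))).continuous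
    have h1 := (hc.integral_hasStrictDerivAt 0 (z i)).hasDerivAt
    rw [Function.update_eq_self] at h1
    have h2 : HasDerivAt (fun t : ℝ => z i + t) 1 0 := (hasDerivAt_id 0).const_add (z i)
    have h3 := (HasDerivAt.comp (0 : ℝ) (by simpa using h1) h2).deriv
    rw [mul_one] at h3
    rw [← h3, partialDeriv, lineDeriv]
    congr 1
    funext t
    have hz (s : ℝ) : Function.update (z + t • Pi.single i 1) i s = Function.update z i s := by
      ext k
      rcases eq_or_ne k i with rfl | hk <;> simp [*]
    simp [hz]
  · intro j hj h0
    funext z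
    rw [partialDeriv, lineDeriv]
    have hz (t s : ℝ) : Function.update (z + t • Pi.single j 1) i s =
        Function.update z i s + t • Pi.single j 1 := by
      ext k
      rcases eq_or_ne k i with rfl | hk
      · simp [hj.symm]
      · simp [hk]
    simp [hz, apply_add_smul_of_partialDeriv_eq_zero hh h0, hj.symm]

/-- The Poincaré lemma for divergence-free fields in space depending on time. -/
theorem exists_curl_of_div_eq_zero {f₁ f₂ f₃ : (Fin 4 → ℝ) → ℝ} (h₁ : ContDiff ℝ ∞ f₁)
    (h₂ : ContDiff ℝ ∞ f₂) (h₃ : ContDiff ℝ ∞ f₃)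
    (h : partialDeriv 1 f₁ + partialDeriv 2 f₂ + partialDeriv 3 f₃ = 0) :
    ∃ θ₁ θ₂ θ₃ : (Fin 4 → ℝ) → ℝ, ContDiff ℝ ∞ θ₁ ∧ ContDiff ℝ ∞ θ₂ ∧ ContDiff ℝ ∞ θ₃ ∧
      f₁ = partialDeriv 2 θ₃ - partialDeriv 3 θ₂ ∧ f₂ = partialDeriv 3 θ₁ - partialDeriv 1 θ₃ ∧
      f₃ = partialDeriv 1 θ₂ - partialDeriv 2 θ₁ := by
  obtain ⟨F₁, hF₁, e₁, -⟩ := exists_partialDeriv_eq h₁ 3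
  obtain ⟨F₂, hF₂, e₂, -⟩ := exists_partialDeriv_eq h₂ 3
  have hG : ContDiff ℝ ∞ (partialDeriv 1 F₁ + partialDeriv 2 F₂) :=
    (contDiff_partialDeriv hF₁ 1).add (contDiff_partialDeriv hF₂ 2)
  have hg : ContDiff ℝ ∞ (f₃ + (partialDeriv 1 F₁ + partialDeriv 2 F₂)) := h₃.add hG
  have hN : ContDiff ℝ ∞ (-F₁) := hF₁.neg
  -- The curl of `(F₂, -F₁, 0)` already gives `f₁` and `f₂`. The defect in the third component is
  -- independent of `x³` since the divergence vanishes, and so is its primitive `Z`; adding `Z` to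
  -- the second potential repairs the third component without disturbing the first.
  obtain ⟨Z, hZ, e₃, hZ0⟩ := exists_partialDeriv_eq hg 1
  have hZ3 : partialDeriv 3 Z = 0 := by
    refine hZ0 3 (by decide) ?_
    rw [partialDeriv_add h₃ hG,
      partialDeriv_add (contDiff_partialDeriv hF₁ 1) (contDiff_partialDeriv hF₂ 2),
      partialDeriv_comm hF₁ 3 1, partialDeriv_comm hF₂ 3 2, e₁, e₂, ← h]
    abel
  have hneg : ∀ i, partialDeriv i (-F₁) = -partialDeriv i F₁ := fun i => by
    funext z
    rw [partialDeriv_eq_fderiv hF₁, partialDeriv_eq_fderiv hN]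
    simp [fderiv_neg]
  have hzero : ∀ i, partialDeriv i (0 : (Fin 4 → ℝ) → ℝ) = 0 := fun i =>
    funext fun z => deriv_const _ _
  refine ⟨F₂, Z + -F₁, 0, hF₂, hZ.add hN, contDiff_const, ?_, ?_, ?_⟩
  · rw [partialDeriv_add hZ hN, hzero, hneg, e₁, hZ3]; abel
  · rw [hzero, e₂]; abel
  · rw [partialDeriv_add hZ hN, hneg, e₃]; abel

/-! ### The homotopy operator -/

/-- Integration of a differential function along the segment towards the zero section. -/
def fibreIntegral (f : JetSpace m → ℝ) (p : JetSpace m) : ℝ :=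
  ∫ y in Icc (0 : ℝ) 1, f (p.1, y • p.2)

theorem contDiff_comp_fibreScale {s : Finset (Fin m × (Fin 4 → ℕ))}
    {g : (Fin 4 → ℝ) × (s → ℝ) → ℝ} (hg : ContDiff ℝ ∞ g) :
    ContDiff ℝ ∞ fun q : ((Fin 4 → ℝ) × (s → ℝ)) × ℝ => g (q.1.1, q.2 • q.1.2) :=
  hg.comp (by fun_prop)

theorem IsDifferentialFunction.fibreIntegral {f : JetSpace m → ℝ}
    (hf : IsDifferentialFunction f) : IsDifferentialFunction (fibreIntegral f) := by
  obtain ⟨s, g, hg, rfl⟩ := hf.exists_jetRestrict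
  exact .of_jetRestrict (s := s)
    (contDiff_setIntegral isCompact_Icc (contDiff_comp_fibreScale hg)) fun _ => rfl

theorem IsDifferentialFunction.continuous_fibreScale {f : JetSpace m → ℝ}
    (hf : IsDifferentialFunction f) (p : JetSpace m) :
    Continuous fun y : ℝ => f (p.1, y • p.2) := by
  obtain ⟨s, g, hg, rfl⟩ := hf.exists_jetRestrict
  exact (contDiff_comp_fibreScale hg).continuous.comp
    (f := fun y : ℝ => (jetRestrict s p, y)) (by fun_prop)

theorem lineDeriv_fibreIntegral {f : JetSpace m → ℝ} (hf : IsDifferentialFunction f)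
    (p v : JetSpace m) : lineDeriv ℝ (fibreIntegral f) p v =
      ∫ y in Icc (0 : ℝ) 1, lineDeriv ℝ f (p.1, y • p.2) (v.1, y • v.2) := by
  obtain ⟨s, g, hg, rfl⟩ := hf.exists_jetRestrict
  have hG := contDiff_comp_fibreScale hg
  have h1 : fibreIntegral (g ∘ jetRestrict s) =
      (fun q : (Fin 4 → ℝ) × (s → ℝ) => ∫ y in Icc (0 : ℝ) 1, g (q.1, y • q.2)) ∘
        jetRestrict s := rfl
  rw [h1, lineDeriv_comp_jetRestrict (contDiff_setIntegral isCompact_Icc hG),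
    fderiv_setIntegral_apply isCompact_Icc (hG.of_le (mod_cast le_top))]
  congr 1
  funext y
  rw [← (hG.differentiable (by simp) _).lineDeriv_eq_fderiv, lineDeriv, lineDeriv]
  congr 1
  funext t
  simp [jetRestrict, LinearMap.funLeft, Function.comp_def, smul_add, smul_comm y t]
  rfl

/-- Integration along the segments towards the zero section, as an operator on differential
functions. -/
def fibreInt : DiffFun m →ₗ[ℝ] DiffFun m where
  toFun f := .mk (fibreIntegral f) f.isDifferentialFunction.fibreIntegral
  map_add' f g := DiffFun.ext fun p => integral_add
    (f.isDifferentialFunction.continuous_fibreScale p).continuousOn.integrableOn_Icc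
    (g.isDifferentialFunction.continuous_fibreScale p).continuousOn.integrableOn_Icc
  map_smul' c _ := DiffFun.ext fun _ => integral_const_mul c _

/-- The fibre components of the total field are linear in the jet coordinates, so scaling the fibre
by `y` carries the field to itself. -/
theorem totalD_fibreInt (i : Fin 4) (f : DiffFun m) :
    totalD i (fibreInt f) = fibreInt (totalD i f) :=
  DiffFun.ext fun p => lineDeriv_fibreIntegral f.isDifferentialFunction p (totalField i p)

/-- Multiplication by a jet coordinate. -/
def coordMul (J : Fin m × (Fin 4 → ℕ)) : DiffFun m →ₗ[ℝ] DiffFun m where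
  toFun f := .mk (fun p => p.2 J * f p)
    ((diffAlg m).mul_mem (isDifferentialFunction_coord J) f.isDifferentialFunction)
  map_add' _ _ := DiffFun.ext fun _ => mul_add _ _ _
  map_smul' _ _ := DiffFun.ext fun _ => mul_left_comm _ _ _

theorem lineDeriv_coord (J : Fin m × (Fin 4 → ℕ)) (p v : JetSpace m) :
    lineDeriv ℝ (fun p : JetSpace m => p.2 J) p v = v.2 J := by
  have : HasDerivAt (fun t : ℝ => p.2 J + t * v.2 J) (1 * v.2 J) 0 :=
    ((hasDerivAt_id (0 : ℝ)).mul_const (v.2 J)).const_add (p.2 J)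
  rw [one_mul] at this
  exact this.deriv

theorem totalD_coordMul (i : Fin 4) (J : Fin m × (Fin 4 → ℕ)) (f : DiffFun m) :
    totalD i (coordMul J f) = coordMul J (totalD i f) + coordMul (jetShift i J) f := by
  refine DiffFun.ext fun p => ?_
  have h := lineDeriv_mul_apply (isDifferentialFunction_coord J) f.isDifferentialFunction p
    (totalField i p)
  rw [lineDeriv_coord, add_comm] at h
  exact h

/-- The homotopy operator, which replaces the variations `δu_J` by the jet coordinates. -/
def homotopyOp : JetForm m →ₗ[ℝ] DiffFun m :=
  Finsupp.lsum ℝ fun J => (coordMul J).comp fibreInt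

theorem homotopyOp_single (J : Fin m × (Fin 4 → ℕ)) (a : DiffFun m) :
    homotopyOp (Finsupp.single J a) = coordMul J (fibreInt a) := by
  simp [homotopyOp]

/-- The Leibniz rule for `u_J a` has the same shape as the rule defining `formD` on `a δu_J`, and
fibre integration commutes with `D_i`. -/
theorem homotopyOp_formD (i : Fin 4) (ξ : JetForm m) :
    homotopyOp (formD i ξ) = totalD i (homotopyOp ξ) := by
  induction ξ using Finsupp.induction_linear with
  | zero => simp
  | add ξ η h₁ h₂ => simp only [map_add, h₁, h₂]
  | single J a =>
    rw [formD_single, map_add, homotopyOp_single, homotopyOp_single, homotopyOp_single,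
      totalD_coordMul, totalD_fibreInt]

/-- This is the fundamental theorem of calculus for `y ↦ f (z, y • u)` on `[0, 1]`. -/
theorem homotopyOp_linearization (f : DiffFun m) (p : JetSpace m) :
    homotopyOp (linearization f) p = f p - f (p.1, 0) := by
  classical
  obtain ⟨s, g, hg, hfg⟩ := f.isDifferentialFunction.exists_jetRestrict
  have hv (y : ℝ) (j : s) : vertD (j : Fin m × (Fin 4 → ℕ)) f (p.1, y • p.2) =
      fderiv ℝ g (p.1, y • (jetRestrict s p).2) (0, Pi.single j 1) := by
    have h1 : jetRestrict s ((0, Pi.single (j : Fin m × (Fin 4 → ℕ)) 1) : JetSpace m) =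
        (0, Pi.single j 1) := by
      ext k
      · simp [jetRestrict]
      · simp [jetRestrict, LinearMap.funLeft, Pi.single_apply]
    rw [vertD, fieldDeriv_apply, hfg, lineDeriv_comp_jetRestrict hg, h1]
    rfl
  have hd (y : ℝ) : HasDerivAt (fun y : ℝ => g (p.1, y • (jetRestrict s p).2))
      (∑ j : s, p.2 j * vertD (j : Fin m × (Fin 4 → ℕ)) f (p.1, y • p.2)) y := by
    have h1 : HasDerivAt (fun y : ℝ => (p.1, y • (jetRestrict s p).2))
        (0, (jetRestrict s p).2) y := by
      simpa using (hasDerivAt_const y p.1).prodMk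
        ((hasDerivAt_id y).smul_const (jetRestrict s p).2)
    have h2 := (hg.differentiable (by simp) _).hasFDerivAt.comp_hasDerivAt y h1
    have h3 : ((0, (jetRestrict s p).2) : (Fin 4 → ℝ) × (s → ℝ)) =
        ∑ j : s, p.2 j • ((0, Pi.single j 1) : (Fin 4 → ℝ) × (s → ℝ)) := by
      ext k
      · simp [Prod.fst_sum]
      · simp [jetRestrict, Prod.snd_sum, Finset.sum_apply, Pi.single_apply, LinearMap.funLeft]
    rw [h3, map_sum] at h2
    simp only [map_smul, smul_eq_mul] at h2
    simp only [hv]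
    exact h2
  have hc (j : Fin m × (Fin 4 → ℕ)) : Continuous fun y : ℝ => p.2 j * vertD j f (p.1, y • p.2) :=
    ((vertD j f).isDifferentialFunction.continuous_fibreScale p).const_mul (p.2 j)
  have hcs : Continuous fun y : ℝ =>
      ∑ j : s, p.2 j * vertD (j : Fin m × (Fin 4 → ℕ)) f (p.1, y • p.2) :=
    continuous_finsetSum _ fun j _ => hc j
  -- The support may be smaller than `s`; the additional terms of the sum vanish.
  have hsupp : (linearization f).support ⊆ s := by
    intro J hJ
    contrapose! hJ
    rw [Finsupp.notMem_support_iff, linearization_apply]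
    refine DiffFun.ext fun q => ?_
    rw [vertD, fieldDeriv_apply, hfg, lineDeriv_comp_jetRestrict hg,
      jetRestrict_single_of_notMem hJ, map_zero]
    rfl
  have h1 : homotopyOp (linearization f) p =
      ∑ j : s, ∫ y in Icc (0 : ℝ) 1, p.2 j * vertD (j : Fin m × (Fin 4 → ℕ)) f (p.1, y • p.2) := by
    rw [homotopyOp, Finsupp.lsum_apply, Finsupp.sum_of_support_subset _ hsupp _ (by simp),
      map_sum, Finset.sum_apply, ← Finset.sum_coe_sort s]
    refine Finset.sum_congr rfl fun j _ => ?_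
    rw [integral_const_mul, linearization_apply]
    rfl
  rw [h1, ← integral_finsetSum (f := fun (j : s) (y : ℝ) =>
      p.2 j * vertD (j : Fin m × (Fin 4 → ℕ)) f (p.1, y • p.2)) _
      fun j _ => (hc j).continuousOn.integrableOn_Icc,
    integral_Icc_eq_integral_Ioc, ← intervalIntegral.integral_of_le zero_le_one,
    intervalIntegral.integral_eq_sub_of_hasDerivAt (fun y _ => hd y)
      (hcs.intervalIntegrable _ _), hfg]
  simp [jetRestrict]

/-! ### Exactness of the total divergence -/

/-- A smooth function of space-time as a differential function. -/
def baseFun (h : (Fin 4 → ℝ) → ℝ) (hh : ContDiff ℝ ∞ h) : DiffFun m :=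
  .mk (fun p => h p.1) (isDifferentialFunction_comp_fst hh)

theorem totalD_baseFun_apply (i : Fin 4) {h : (Fin 4 → ℝ) → ℝ} (hh : ContDiff ℝ ∞ h)
    (p : JetSpace m) : totalD i (baseFun h hh) p = partialDeriv i h p.1 := rfl

theorem DiffFun.contDiff_zeroSection (f : DiffFun m) :
    ContDiff ℝ ∞ fun z : Fin 4 → ℝ => f (z, 0) := by
  obtain ⟨s, g, hg, hfg⟩ := f.isDifferentialFunction.exists_jetRestrict
  rw [hfg]
  exact hg.comp (f := fun z : Fin 4 → ℝ => (z, (0 : s → ℝ))) (by fun_prop)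

/-- The total field is tangent to the zero section. -/
theorem partialDeriv_zeroSection (i : Fin 4) (f : DiffFun m) (z : Fin 4 → ℝ) :
    partialDeriv i (fun z => f (z, 0)) z = totalD i f (z, 0) := by
  rw [totalD, fieldDeriv_apply, partialDeriv, lineDeriv, lineDeriv]
  congr 1
  funext t
  refine congrArg f (Prod.ext rfl (funext fun J => ?_))
  simp [totalField]

/-- A differential vector function with vanishing total divergence is a total curl. -/
theorem exists_totalD_curl {f₁ f₂ f₃ : DiffFun m}
    (h : totalD 1 f₁ + totalD 2 f₂ + totalD 3 f₃ = 0) :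
    ∃ θ₁ θ₂ θ₃ : DiffFun m, f₁ = totalD 2 θ₃ - totalD 3 θ₂ ∧ f₂ = totalD 3 θ₁ - totalD 1 θ₃ ∧
      f₃ = totalD 1 θ₂ - totalD 2 θ₁ := by
  have hlin : formD 1 (linearization f₁) + formD 2 (linearization f₂) +
      formD 3 (linearization f₃) = 0 := by
    rw [← linearization_totalD, ← linearization_totalD, ← linearization_totalD,
      ← linearization_add, ← linearization_add, h]
    ext1 J
    rw [linearization_apply, map_zero]
    rfl
  obtain ⟨η₁, η₂, η₃, e₁, e₂, e₃⟩ := exists_form_curl hlin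
  obtain ⟨θ₁, θ₂, θ₃, k₁, k₂, k₃, d₁, d₂, d₃⟩ := exists_curl_of_div_eq_zero
    f₁.contDiff_zeroSection f₂.contDiff_zeroSection f₃.contDiff_zeroSection (by
      funext z
      simp only [Pi.add_apply, partialDeriv_zeroSection]
      exact congrArg (fun f : DiffFun m => f (z, 0)) h)
  -- Each component is the homotopy of its linearization plus its restriction to the zero section,
  -- and the potentials of the two parts add.
  have key {f : DiffFun m} {i j : Fin 4} {η η' : JetForm m} {θ θ' : (Fin 4 → ℝ) → ℝ}
      (hθ : ContDiff ℝ ∞ θ) (hθ' : ContDiff ℝ ∞ θ')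
      (e : linearization f = formD i η - formD j η')
      (d : (fun z => f (z, 0)) = partialDeriv i θ - partialDeriv j θ') :
      f = totalD i (homotopyOp η + baseFun θ hθ) - totalD j (homotopyOp η' + baseFun θ' hθ') := by
    refine DiffFun.ext fun p => ?_
    have h1 := homotopyOp_linearization f p
    have h2 := congrFun d p.1
    rw [e, map_sub, homotopyOp_formD, homotopyOp_formD, DiffFun.sub_apply] at h1
    simp only [Pi.sub_apply] at h2
    rw [map_add, map_add, DiffFun.sub_apply, DiffFun.add_apply, DiffFun.add_apply,
      totalD_baseFun_apply, totalD_baseFun_apply]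
    linarith
  exact ⟨homotopyOp η₁ + baseFun θ₁ k₁, homotopyOp η₂ + baseFun θ₂ k₂,
    homotopyOp η₃ + baseFun θ₃ k₃, key k₃ k₂ e₁ d₁, key k₁ k₃ e₂ d₂, key k₂ k₁ e₃ d₃⟩

/-! ### Iterated partial derivatives -/

/-- The smooth functions on space-time. -/
def smoothFun : Submodule ℝ ((Fin 4 → ℝ) → ℝ) where
  carrier := {f | ContDiff ℝ ∞ f}
  add_mem' {f g} (h₁ : ContDiff ℝ ∞ f) (h₂ : ContDiff ℝ ∞ g) := (h₁.add h₂ : ContDiff ℝ ∞ _)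
  zero_mem' := (contDiff_const : ContDiff ℝ ∞ fun _ : Fin 4 → ℝ => (0 : ℝ))
  smul_mem' c f (h : ContDiff ℝ ∞ f) := (h.const_smul c : ContDiff ℝ ∞ _)

theorem contDiff_coe (f : smoothFun) : ContDiff ℝ ∞ (f : (Fin 4 → ℝ) → ℝ) := f.2

/-- The partial derivative as a linear operator on smooth functions. -/
def partialD (i : Fin 4) : Module.End ℝ smoothFun where
  toFun f := ⟨partialDeriv i f, contDiff_partialDeriv f.2 i⟩
  map_add' f g := Subtype.ext (partialDeriv_add f.2 g.2 i)
  map_smul' c f := Subtype.ext <| funext fun z => (HasDerivAt.const_smul c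
    (((contDiff_coe f).differentiable (by simp) z).lineDifferentiableAt (v := Pi.single i 1)).hasLineDerivAt).deriv

theorem commute_partialD (i j : Fin 4) : Commute (partialD i) (partialD j) :=
  LinearMap.ext fun f => Subtype.ext (partialDeriv_comm f.2 i j)

theorem coe_partialD_pow (i : Fin 4) (n : ℕ) (f : smoothFun) :
    ((partialD i ^ n) f : (Fin 4 → ℝ) → ℝ) = (partialDeriv i)^[n] f := by
  induction n with
  | zero => rfl
  | succ n ih => rw [pow_succ', Function.iterate_succ_apply', ← ih]; rfl

/-- The iterated partial derivative as a linear operator on smooth functions. -/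
def iterPartialD (I : Fin 4 → ℕ) : Module.End ℝ smoothFun :=
  partialD 0 ^ I 0 * (partialD 1 ^ I 1 * (partialD 2 ^ I 2 * partialD 3 ^ I 3))

theorem coe_iterPartialD (I : Fin 4 → ℕ) (f : smoothFun) :
    (iterPartialD I f : (Fin 4 → ℝ) → ℝ) = iterPartialDeriv I f := by
  simp only [iterPartialD, Module.End.mul_apply, coe_partialD_pow, iterPartialDeriv]

theorem contDiff_iterPartialDeriv {f : (Fin 4 → ℝ) → ℝ} (hf : ContDiff ℝ ∞ f) (I : Fin 4 → ℕ) :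
    ContDiff ℝ ∞ (iterPartialDeriv I f) :=
  coe_iterPartialD I ⟨f, hf⟩ ▸ (iterPartialD I ⟨f, hf⟩).2

/-- The additional operator is moved past the factors with smaller index, one at a time. -/
theorem iterPartialD_add_single (I : Fin 4 → ℕ) (i : Fin 4) :
    iterPartialD (I + Pi.single i 1) = partialD i * iterPartialD I := by
  have h (j : Fin 4) : Commute (partialD i) (partialD j ^ I j) := (commute_partialD i j).pow_right _
  unfold iterPartialD
  fin_cases i
  · simp [pow_succ', mul_assoc]
  · simp only [← mul_assoc, (h 0).eq]
    simp [pow_succ', mul_assoc]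
  · simp only [← mul_assoc, (h 0).eq]
    simp only [mul_assoc]
    simp only [← mul_assoc (partialD _) (partialD _ ^ _), (h 1).eq]
    simp [pow_succ', mul_assoc]
  · simp only [← mul_assoc, (h 0).eq]
    simp only [mul_assoc]
    simp only [← mul_assoc (partialD _) (partialD _ ^ _), (h 1).eq]
    simp only [mul_assoc]
    simp only [← mul_assoc (partialD _) (partialD _ ^ _), (h 2).eq]
    simp [pow_succ', mul_assoc]

theorem partialDeriv_iterPartialDeriv {f : (Fin 4 → ℝ) → ℝ} (hf : ContDiff ℝ ∞ f)
    (I : Fin 4 → ℕ) (i : Fin 4) :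
    partialDeriv i (iterPartialDeriv I f) = iterPartialDeriv (I + Pi.single i 1) f := by
  have := congrArg (fun T : Module.End ℝ smoothFun => (T ⟨f, hf⟩ : (Fin 4 → ℝ) → ℝ))
    (iterPartialD_add_single I i)
  simp only [coe_iterPartialD] at this
  rw [this, Module.End.mul_apply]
  exact congrArg (partialDeriv i) (coe_iterPartialD I ⟨f, hf⟩).symm

/-! ### Differential functions along jets -/

theorem contDiff_jetRestrict_jet {u : (Fin 4 → ℝ) → Fin m → ℝ} (hu : ContDiff ℝ ∞ u)
    (s : Finset (Fin m × (Fin 4 → ℕ))) : ContDiff ℝ ∞ fun z => jetRestrict s (jet u z) :=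
  contDiff_id.prodMk (contDiff_pi.2 fun j =>
    contDiff_iterPartialDeriv (contDiff_pi.1 hu (j : Fin m × (Fin 4 → ℕ)).1) _)

theorem IsDifferentialFunction.contDiff_comp_jet {f : JetSpace m → ℝ}
    (hf : IsDifferentialFunction f) {u : (Fin 4 → ℝ) → Fin m → ℝ} (hu : ContDiff ℝ ∞ u) :
    ContDiff ℝ ∞ fun z => f (jet u z) := by
  obtain ⟨s, g, hg, rfl⟩ := hf.exists_jetRestrict
  exact hg.comp (contDiff_jetRestrict_jet hu s)

/-- The total derivative of a differential function is its derivative along jets. -/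
theorem IsDifferentialFunction.partialDeriv_comp_jet {f : JetSpace m → ℝ}
    (hf : IsDifferentialFunction f) {u : (Fin 4 → ℝ) → Fin m → ℝ} (hu : ContDiff ℝ ∞ u)
    (i : Fin 4) (z : Fin 4 → ℝ) :
    partialDeriv i (fun z => f (jet u z)) z = totalDeriv i f (jet u z) := by
  obtain ⟨s, g, hg, rfl⟩ := hf.exists_jetRestrict
  -- The velocity of the jet of `u` along the `i`-th axis is the total field.
  have h1 : HasDerivAt (fun t : ℝ => jetRestrict s (jet u (z + t • Pi.single i 1)))
      (jetRestrict s (totalField i (jet u z))) 0 := by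
    refine HasDerivAt.prodMk ?_ (hasDerivAt_pi.2 fun j => ?_)
    · have := ((hasDerivAt_id (0 : ℝ)).smul_const (Pi.single i 1 : Fin 4 → ℝ)).const_add z
      rw [one_smul] at this
      exact this
    · have hj := contDiff_pi.1 hu (j : Fin m × (Fin 4 → ℕ)).1
      have h2 := ((contDiff_iterPartialDeriv hj (j : Fin m × (Fin 4 → ℕ)).2).differentiable
        (by simp) z).lineDifferentiableAt (v := Pi.single i 1)
      have h3 := h2.hasLineDerivAt
      rw [← partialDeriv, partialDeriv_iterPartialDeriv hj] at h3
      exact h3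
  have h2 : HasFDerivAt g (fderiv ℝ g (jetRestrict s (jet u z)))
      (jetRestrict s (jet u (z + (0 : ℝ) • Pi.single i 1))) := by
    rw [zero_smul, add_zero]
    exact (hg.differentiable (by simp) _).hasFDerivAt
  exact (h2.comp_hasDerivAt (0 : ℝ) h1).deriv.trans (lineDeriv_comp_jetRestrict hg _ _).symm

/-! ### Prescribing finite jets -/

/-- A product of functions of one variable. -/
def prodFun (φ : Fin 4 → ℝ → ℝ) (z : Fin 4 → ℝ) : ℝ := ∏ k, φ k (z k)

theorem partialDeriv_prodFun (φ : Fin 4 → ℝ → ℝ) (i : Fin 4) :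
    partialDeriv i (prodFun φ) = prodFun (Function.update φ i (deriv (φ i))) := by
  funext z
  have h (ψ : Fin 4 → ℝ → ℝ) (w : Fin 4 → ℝ) :
      prodFun ψ w = ψ i (w i) * ∏ k ∈ Finset.univ.erase i, ψ k (w k) :=
    (Finset.mul_prod_erase Finset.univ (fun k => ψ k (w k)) (Finset.mem_univ i)).symm
  have h1 (t : ℝ) : prodFun φ (z + t • Pi.single i 1) =
      φ i (z i + t) * ∏ k ∈ Finset.univ.erase i, φ k (z k) := by
    rw [h]
    congr 1
    · simp
    · refine Finset.prod_congr rfl fun k hk => ?_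
      simp [Finset.ne_of_mem_erase hk]
  rw [partialDeriv, lineDeriv, h]
  simp only [h1]
  rw [deriv_mul_const_field, deriv_comp_const_add, add_zero, Function.update_self]
  congr 1
  refine Finset.prod_congr rfl fun k hk => ?_
  rw [Function.update_of_ne (Finset.ne_of_mem_erase hk)]

theorem iterate_partialDeriv_prodFun (φ : Fin 4 → ℝ → ℝ) (i : Fin 4) (n : ℕ) :
    (partialDeriv i)^[n] (prodFun φ) = prodFun (Function.update φ i (iteratedDeriv n (φ i))) := by
  induction n with
  | zero => simp
  | succ n ih =>
    rw [Function.iterate_succ_apply', ih, partialDeriv_prodFun, Function.update_idem,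
      Function.update_self, iteratedDeriv_succ]

theorem iterPartialDeriv_prodFun (φ : Fin 4 → ℝ → ℝ) (I : Fin 4 → ℕ) :
    iterPartialDeriv I (prodFun φ) = prodFun fun k => iteratedDeriv (I k) (φ k) := by
  simp only [iterPartialDeriv, iterate_partialDeriv_prodFun]
  congr 1
  funext k
  fin_cases k <;> simp

theorem contDiff_prodFun {φ : Fin 4 → ℝ → ℝ} (hφ : ∀ k, ContDiff ℝ ∞ (φ k)) :
    ContDiff ℝ ∞ (prodFun φ) :=
  contDiff_prod fun k _ => (hφ k).comp (contDiff_apply ℝ ℝ k)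

/-- The monomial of multidegree `J` centred at `c`, with `∂^J` equal to one. -/
def jetMonomial (c : Fin 4 → ℝ) (J : Fin 4 → ℕ) : (Fin 4 → ℝ) → ℝ :=
  prodFun fun k x => ((J k).factorial : ℝ)⁻¹ * (x - c k) ^ J k

theorem contDiff_jetMonomial (c : Fin 4 → ℝ) (J : Fin 4 → ℕ) : ContDiff ℝ ∞ (jetMonomial c J) :=
  contDiff_prodFun fun k => by fun_prop

theorem iterPartialDeriv_jetMonomial (c : Fin 4 → ℝ) (I J : Fin 4 → ℕ) :
    iterPartialDeriv I (jetMonomial c J) c = if I = J then 1 else 0 := by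
  have h (k : Fin 4) : iteratedDeriv (I k)
      (fun x => ((J k).factorial : ℝ)⁻¹ * (x - c k) ^ J k) (c k) = if I k = J k then 1 else 0 := by
    have h1 := congrFun (iteratedDeriv_comp_sub_const (I k)
      (fun x : ℝ => ((J k).factorial : ℝ)⁻¹ * x ^ J k) (c k)) (c k)
    refine h1.trans ?_
    rw [sub_self, iteratedDeriv_const_mul_field, iteratedDeriv_fun_pow_zero]
    split_ifs with h2
    · exact inv_mul_cancel₀ (Nat.cast_ne_zero.2 (Nat.factorial_ne_zero _))
    · simp
  rw [jetMonomial, iterPartialDeriv_prodFun, prodFun]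
  simp only [h]
  split_ifs with hIJ
  · simp [hIJ]
  · obtain ⟨k, hk⟩ := Function.ne_iff.1 hIJ
    exact Finset.prod_eq_zero (Finset.mem_univ k) (if_neg hk)

/-- Finitely many jet coordinates at a point can be prescribed. -/
theorem exists_jetRestrict_jet_eq (s : Finset (Fin m × (Fin 4 → ℕ))) (p : JetSpace m) :
    ∃ u : (Fin 4 → ℝ) → Fin m → ℝ, ContDiff ℝ ∞ u ∧ jetRestrict s (jet u p.1) = jetRestrict s p := by
  classical
  -- The Taylor polynomial at `p.1` with the prescribed coefficients for the indices in `s`.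
  let w : Fin m → smoothFun := fun α => ∑ j ∈ s,
    (if j.1 = α then p.2 j else 0) • (⟨_, contDiff_jetMonomial p.1 j.2⟩ : smoothFun)
  refine ⟨fun z α => (w α : (Fin 4 → ℝ) → ℝ) z, contDiff_pi.2 fun α => (w α).2, ?_⟩
  refine Prod.ext rfl (funext fun ⟨J, hJ⟩ => ?_)
  change iterPartialDeriv J.2 (w J.1 : (Fin 4 → ℝ) → ℝ) p.1 = p.2 J
  rw [← coe_iterPartialD, map_sum]
  simp only [map_smul, AddSubmonoidClass.coe_finsetSum, Submodule.coe_smul, Finset.sum_apply,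
    Pi.smul_apply, coe_iterPartialD, iterPartialDeriv_jetMonomial, smul_eq_mul]
  rw [Finset.sum_eq_single J]
  · simp
  · intro j _ hj
    by_cases h1 : j.1 = J.1
    · rw [if_neg (c := J.2 = j.2) fun h2 => hj (Prod.ext h1 h2.symm), mul_zero]
    · rw [if_neg h1, zero_mul]
  · exact fun h => absurd hJ h

/-- A differential function that vanishes along all jets of smooth functions is zero. -/
theorem IsDifferentialFunction.eq_zero_of_comp_jet {f : JetSpace m → ℝ}
    (hf : IsDifferentialFunction f)
    (h : ∀ u : (Fin 4 → ℝ) → Fin m → ℝ, ContDiff ℝ ∞ u → ∀ z, f (jet u z) = 0) (p : JetSpace m) :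
    f p = 0 := by
  obtain ⟨s, g, hg, rfl⟩ := hf.exists_jetRestrict
  obtain ⟨u, hu, hp⟩ := exists_jetRestrict_jet_eq s p
  have := h u hu p.1
  rwa [Function.comp_apply, hp] at this

/-! ### Fields at a fixed time -/

theorem contDiff_fieldAt {X : Fin 3 → JetSpace m → ℝ} (hX : ∀ i, IsDifferentialFunction (X i))
    {u : (Fin 4 → ℝ) → Fin m → ℝ} (hu : ContDiff ℝ ∞ u) (t : ℝ) :
    ContDiff ℝ ∞ (fieldAt X u t) := by
  refine contDiff_pi.2 fun i => ((hX i).contDiff_comp_jet hu).comp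
    (f := fun x : Fin 3 → ℝ => (Fin.cons t x : Fin 4 → ℝ)) (contDiff_pi.2 fun k => ?_)
  refine Fin.cases ?_ (fun j => ?_) k
  · simpa using contDiff_const
  · simpa using contDiff_apply ℝ ℝ j

theorem fderiv_fieldAt {X : Fin 3 → JetSpace m → ℝ} (hX : ∀ i, IsDifferentialFunction (X i))
    {u : (Fin 4 → ℝ) → Fin m → ℝ} (hu : ContDiff ℝ ∞ u) (t : ℝ) (x : Fin 3 → ℝ) (i j : Fin 3) :
    fderiv ℝ (fieldAt X u t) x (Pi.single j 1) i =
      totalDeriv j.succ (X i) (jet u (Fin.cons t x)) := by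
  have hd := (contDiff_fieldAt hX hu t).differentiable (by simp) x
  have h1 : HasDerivAt (fun s : ℝ => fieldAt X u t (x + s • Pi.single j 1))
      (fderiv ℝ (fieldAt X u t) x (Pi.single j 1)) 0 := hd.hasFDerivAt.hasLineDerivAt _
  rw [← (hasDerivAt_pi.1 h1 i).deriv, ← (hX i).partialDeriv_comp_jet hu, partialDeriv, lineDeriv]
  congr 1
  funext s
  have : (Fin.cons t (x + s • Pi.single j 1) : Fin 4 → ℝ) =
      Fin.cons t x + s • Pi.single j.succ 1 := by
    ext k
    refine Fin.cases ?_ (fun l => ?_) k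
    · simp
    · simp [Pi.single_apply, Fin.succ_inj]
  rw [fieldAt, this]

/-! ### Stokes' theorem on a patch -/

/-- The curl of a vector field in space. -/
def curl (A : (Fin 3 → ℝ) → Fin 3 → ℝ) (x : Fin 3 → ℝ) : Fin 3 → ℝ :=
  ![fderiv ℝ A x (Pi.single 1 1) 2 - fderiv ℝ A x (Pi.single 2 1) 1,
    fderiv ℝ A x (Pi.single 2 1) 0 - fderiv ℝ A x (Pi.single 0 1) 2,
    fderiv ℝ A x (Pi.single 0 1) 1 - fderiv ℝ A x (Pi.single 1 1) 0]

theorem fieldAt_totalCurl {Θ : Fin 3 → JetSpace m → ℝ} (hΘ : ∀ i, IsDifferentialFunction (Θ i))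
    {u : (Fin 4 → ℝ) → Fin m → ℝ} (hu : ContDiff ℝ ∞ u) (t : ℝ) :
    fieldAt (totalCurl Θ) u t = curl (fieldAt Θ u t) := by
  funext x i
  simp only [curl, fderiv_fieldAt hΘ hu]
  fin_cases i <;> rfl

theorem map_apply_eq_sum_single (T : (Fin 3 → ℝ) →L[ℝ] Fin 3 → ℝ) (v : Fin 3 → ℝ) (i : Fin 3) :
    T v i = ∑ j, v j * T (Pi.single j 1) i := by
  conv_lhs => rw [pi_eq_sum_univ' v]
  simp [map_sum, Finset.sum_apply]

/-- The curl represents the antisymmetric part of the derivative; in this form the flux density can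
be pulled back to the parameter square. -/
theorem curl_dotProduct_cross (A : (Fin 3 → ℝ) → Fin 3 → ℝ) (x v w : Fin 3 → ℝ) :
    curl A x ⬝ᵥ (v ⨯₃ w) = fderiv ℝ A x v ⬝ᵥ w - fderiv ℝ A x w ⬝ᵥ v := by
  simp only [dotProduct, Fin.sum_univ_three, map_apply_eq_sum_single _ v,
    map_apply_eq_sum_single _ w, curl, cross_apply]
  simp
  ring

theorem fderiv_dotProduct {E : Type*} [NormedAddCommGroup E] [NormedSpace ℝ E]
    {a b : E → Fin 3 → ℝ} {p : E} (ha : DifferentiableAt ℝ a p) (hb : DifferentiableAt ℝ b p)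
    (v : E) : fderiv ℝ (fun p => a p ⬝ᵥ b p) p v =
      fderiv ℝ a p v ⬝ᵥ b p + a p ⬝ᵥ fderiv ℝ b p v := by
  have ha' := hasFDerivAt_pi'.1 ha.hasFDerivAt
  have hb' := hasFDerivAt_pi'.1 hb.hasFDerivAt
  have h := HasFDerivAt.fun_sum (u := Finset.univ) fun i _ => (ha' i).mul (hb' i)
  refine (congrArg (· v) (HasFDerivAt.fderiv h)).trans ?_
  simp only [dotProduct, ← Finset.sum_add_distrib]
  simp [add_comm, mul_comm]

theorem contDiff_dotProduct {E : Type*} [NormedAddCommGroup E] [NormedSpace ℝ E]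
    {a b : E → Fin 3 → ℝ} (ha : ContDiff ℝ ∞ a) (hb : ContDiff ℝ ∞ b) :
    ContDiff ℝ ∞ fun p => a p ⬝ᵥ b p :=
  ContDiff.sum fun i _ => (contDiff_pi.1 ha i).mul (contDiff_pi.1 hb i)

/-- The line integral of a vector field along a curve parametrized by the unit interval. -/
def lineIntegral (A : (Fin 3 → ℝ) → Fin 3 → ℝ) (γ : ℝ → Fin 3 → ℝ) : ℝ :=
  ∫ s in (0 : ℝ)..1, A (γ s) ⬝ᵥ deriv γ s

/-- At the endpoints the derivatives may differ, as the curves need not agree beyond them; the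
interior determines the integral. -/
theorem lineIntegral_congr (A : (Fin 3 → ℝ) → Fin 3 → ℝ) {γ γ' : ℝ → Fin 3 → ℝ}
    (h : ∀ s ∈ Icc (0 : ℝ) 1, γ s = γ' s) : lineIntegral A γ = lineIntegral A γ' := by
  refine intervalIntegral.integral_congr_Ioo_of_le zero_le_one fun s hs => ?_
  have h1 : γ =ᶠ[nhds s] γ' := by
    filter_upwards [Icc_mem_nhds hs.1 hs.2] with r hr using h r hr
  simp only [h1.deriv_eq, h s (Ioo_subset_Icc_self hs)]

theorem lineIntegral_reverse (A : (Fin 3 → ℝ) → Fin 3 → ℝ) (γ : ℝ → Fin 3 → ℝ) :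
    lineIntegral A (fun s => γ (1 - s)) = -lineIntegral A γ := by
  simp only [lineIntegral, deriv_comp_const_sub, dotProduct_neg, intervalIntegral.integral_neg]
  rw [intervalIntegral.integral_comp_sub_left (fun s => A (γ s) ⬝ᵥ deriv γ s) 1]
  simp

theorem lineIntegral_const (A : (Fin 3 → ℝ) → Fin 3 → ℝ) (c : Fin 3 → ℝ) :
    lineIntegral A (fun _ => c) = 0 := by
  simp [lineIntegral]

theorem closedSquare_eq_Icc : closedSquare = Icc ((0, 0) : ℝ × ℝ) (1, 1) :=
  Icc_prod_Icc _ _ _ _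

/-- Stokes' theorem for a smooth patch. -/
theorem integral_curl_patch {A : (Fin 3 → ℝ) → Fin 3 → ℝ} (hA : ContDiff ℝ ∞ A)
    {φ : ℝ × ℝ → Fin 3 → ℝ} (hφ : ContDiff ℝ ∞ φ) :
    ∫ p in closedSquare, curl A (φ p) ⬝ᵥ patchNormal φ p =
      ∑ j, lineIntegral A fun s => φ (squareEdge j s) := by
  have hAφ : ContDiff ℝ ∞ fun p => A (φ p) := hA.comp hφ
  have hD : ContDiff ℝ ∞ (fderiv ℝ φ) := hφ.fderiv_right (by simp)
  have hDv (v : ℝ × ℝ) : ContDiff ℝ ∞ fun p => fderiv ℝ φ p v := hD.clm_apply contDiff_const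
  have hF (v : ℝ × ℝ) : ContDiff ℝ ∞ fun p => A (φ p) ⬝ᵥ fderiv ℝ φ p v :=
    contDiff_dotProduct hAφ (hDv v)
  have hdF (v w : ℝ × ℝ) (p : ℝ × ℝ) : fderiv ℝ (fun p => A (φ p) ⬝ᵥ fderiv ℝ φ p v) p w =
      fderiv ℝ A (φ p) (fderiv ℝ φ p w) ⬝ᵥ fderiv ℝ φ p v +
        A (φ p) ⬝ᵥ fderiv ℝ (fderiv ℝ φ) p w v := by
    rw [fderiv_dotProduct (hAφ.differentiable (by simp) p) ((hDv v).differentiable (by simp) p)]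
    congr 2
    · exact congrArg (· w) (((hA.differentiable (by simp) _).hasFDerivAt.comp p
        (hφ.differentiable (by simp) p).hasFDerivAt).fderiv)
    · have h := ((hD.differentiable (by simp) p).hasFDerivAt.clm_apply
        (hasFDerivAt_const v p)).fderiv
      simp only [h]
      simp
  -- The integrand is the exterior derivative of the pulled-back 1-form with components `A · ∂₁φ`
  -- and `A · ∂₂φ`; the second derivatives of `φ` cancel.
  have hdiv (p : ℝ × ℝ) : curl A (φ p) ⬝ᵥ patchNormal φ p =
      fderiv ℝ (fun p => A (φ p) ⬝ᵥ fderiv ℝ φ p (0, 1)) p (1, 0) +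
        (-fderiv ℝ (fun p => A (φ p) ⬝ᵥ fderiv ℝ φ p (1, 0)) p) (0, 1) := by
    rw [patchNormal, curl_dotProduct_cross, neg_apply, hdF, hdF,
      (hφ.contDiffAt.isSymmSndFDerivAt (by simpa using two_le_infty)).eq (1, 0) (0, 1)]
    ring
  have hcont : Continuous fun p => curl A (φ p) ⬝ᵥ patchNormal φ p := by
    simp only [hdiv]
    exact (((hF (0, 1)).continuous_fderiv (by simp)).clm_apply continuous_const).add
      (((hF (1, 0)).continuous_fderiv (by simp)).neg.clm_apply continuous_const)
  have hcurve (c : ℝ → ℝ × ℝ) (c' : ℝ × ℝ) (hc : ∀ s, HasDerivAt c c' s) :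
      lineIntegral A (fun s => φ (c s)) =
        ∫ s in (0 : ℝ)..1, A (φ (c s)) ⬝ᵥ fderiv ℝ φ (c s) c' := by
    refine intervalIntegral.integral_congr fun s _ => ?_
    have h := ((hφ.differentiable (by simp) (c s)).hasFDerivAt.comp_hasDerivAt s (hc s)).deriv
    simp only [← h]
    rfl
  have e0 : lineIntegral A (fun s => φ (squareEdge 0 s)) =
      ∫ s in (0 : ℝ)..1, A (φ (s, 0)) ⬝ᵥ fderiv ℝ φ (s, 0) (1, 0) :=
    hcurve _ _ fun s => (hasDerivAt_id s).prodMk (hasDerivAt_const s 0)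
  have e1 : lineIntegral A (fun s => φ (squareEdge 1 s)) =
      ∫ s in (0 : ℝ)..1, A (φ (1, s)) ⬝ᵥ fderiv ℝ φ (1, s) (0, 1) :=
    hcurve _ _ fun s => (hasDerivAt_const s 1).prodMk (hasDerivAt_id s)
  -- The edges `2` and `3` are run through backwards, hence the signs.
  have e2 : lineIntegral A (fun s => φ (squareEdge 2 s)) =
      -∫ s in (0 : ℝ)..1, A (φ (s, 1)) ⬝ᵥ fderiv ℝ φ (s, 1) (1, 0) :=
    (lineIntegral_reverse A fun s => φ (s, 1)).trans (congrArg Neg.neg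
      (hcurve _ _ fun s => (hasDerivAt_id s).prodMk (hasDerivAt_const s 1)))
  have e3 : lineIntegral A (fun s => φ (squareEdge 3 s)) =
      -∫ s in (0 : ℝ)..1, A (φ (0, s)) ⬝ᵥ fderiv ℝ φ (0, s) (0, 1) :=
    (lineIntegral_reverse A fun s => φ (0, s)).trans (congrArg Neg.neg
      (hcurve _ _ fun s => (hasDerivAt_const s 0).prodMk (hasDerivAt_id s)))
  -- Green's theorem, as the divergence theorem for the 1-form turned by a right angle.
  have hdivthm := integral_divergence_prod_Icc_of_hasFDerivAt_of_le
    (fun p => A (φ p) ⬝ᵥ fderiv ℝ φ p (0, 1)) (fun p => -(A (φ p) ⬝ᵥ fderiv ℝ φ p (1, 0)))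
    (fderiv ℝ fun p => A (φ p) ⬝ᵥ fderiv ℝ φ p (0, 1))
    (fun p => -fderiv ℝ (fun p => A (φ p) ⬝ᵥ fderiv ℝ φ p (1, 0)) p) (0, 0) (1, 1)
    (Prod.mk_le_mk.2 ⟨zero_le_one, zero_le_one⟩)
    (hF _).continuous.continuousOn (hF _).continuous.neg.continuousOn
    (fun p _ => ((hF _).differentiable (by simp) p).hasFDerivAt)
    (fun p _ => ((hF _).differentiable (by simp) p).hasFDerivAt.neg)
    (by simpa only [← hdiv] using hcont.continuousOn.integrableOn_compact isCompact_Icc)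
  simp only [← hdiv] at hdivthm
  rw [closedSquare_eq_Icc, hdivthm, Fin.sum_univ_four, e0, e1, e2, e3,
    intervalIntegral.integral_neg, intervalIntegral.integral_neg]
  ring

/-- The flux of a curl through a closed surface vanishes. -/
theorem ClosedSurface.flux_curl (S : ClosedSurface) {A : (Fin 3 → ℝ) → Fin 3 → ℝ}
    (hA : ContDiff ℝ ∞ A) : S.flux (curl A) = 0 := by
  classical
  let I : Fin S.n × Fin 4 → ℝ := fun e => lineIntegral A fun s => S.patch e.1 (squareEdge e.2 s)
  let P : Fin S.n × Fin 4 → Prop := fun e =>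
    ∃ c, ∀ s ∈ Icc (0 : ℝ) 1, S.patch e.1 (squareEdge e.2 s) = c
  have hflux : S.flux (curl A) = ∑ e, I e := by
    rw [ClosedSurface.flux, Fintype.sum_prod_type]
    exact Finset.sum_congr rfl fun k _ => integral_curl_patch hA (S.smooth k)
  have hP {e} (he : P e) : I e = 0 := by
    obtain ⟨c, hc⟩ := he
    exact (lineIntegral_congr A hc).trans (lineIntegral_const A c)
  -- The partner of an edge that is not collapsed is not collapsed either, which makes `σ` below an
  -- involution even though `glue` is arbitrary on collapsed edges.
  have hglue {e} (he : ¬P e) : S.glue (S.glue e) = e ∧ I (S.glue e) = -I e ∧ ¬P (S.glue e) := by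
    obtain ⟨-, h2, h3⟩ := (S.edges e).resolve_left he
    refine ⟨h2, (lineIntegral_congr A h3).trans
      (lineIntegral_reverse A fun s => S.patch e.1 (squareEdge e.2 s)), ?_⟩
    rintro ⟨c, hc⟩
    refine he ⟨c, fun s hs => ?_⟩
    have hs' : 1 - s ∈ Icc (0 : ℝ) 1 := ⟨by linarith [hs.2], by linarith [hs.1]⟩
    rw [← hc _ hs', h3 _ hs', sub_sub_cancel]
  let σ : Fin S.n × Fin 4 → Fin S.n × Fin 4 := fun e => if P e then e else S.glue e
  have hσ : Function.Involutive σ := fun e => by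
    by_cases he : P e
    · simp only [σ, if_pos he]
    · simp only [σ, if_neg he, if_neg (hglue he).2.2, (hglue he).1]
  have hI (e) : I (σ e) = -I e := by
    by_cases he : P e
    · simp only [σ, if_pos he, hP he, neg_zero]
    · simp only [σ, if_neg he, (hglue he).2.1]
  -- Reindexing by `σ` shows that the sum equals its own negative.
  have hsum := Equiv.sum_comp hσ.toPerm I
  simp only [Function.Involutive.coe_toPerm, hI, Finset.sum_neg_distrib] at hsum
  rw [hflux]
  linarith

/-! ### Spheres as closed surfaces -/

/-- The unit sphere in spherical coordinates, with parameters in the unit square. -/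
def sphereCoord (p : ℝ × ℝ) : Fin 3 → ℝ :=
  ![Real.sin (Real.pi * p.1) * Real.cos (2 * Real.pi * p.2),
    Real.sin (Real.pi * p.1) * Real.sin (2 * Real.pi * p.2), Real.cos (Real.pi * p.1)]

/-- The sphere with centre `c` and radius `r` in spherical coordinates. -/
def spherePatch (c : Fin 3 → ℝ) (r : ℝ) (p : ℝ × ℝ) : Fin 3 → ℝ := c + r • sphereCoord p

theorem contDiff_sphereCoord : ContDiff ℝ ∞ sphereCoord := by
  refine contDiff_pi.2 fun i => ?_
  fin_cases i <;> simp [sphereCoord] <;> fun_prop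

theorem contDiff_spherePatch (c : Fin 3 → ℝ) (r : ℝ) : ContDiff ℝ ∞ (spherePatch c r) :=
  contDiff_const.add (contDiff_sphereCoord.const_smul r)

theorem patchNormal_spherePatch (c : Fin 3 → ℝ) (r : ℝ) (p : ℝ × ℝ) :
    patchNormal (spherePatch c r) p =
      (r ^ 2 * (2 * Real.pi ^ 2 * Real.sin (Real.pi * p.1))) • sphereCoord p := by
  obtain ⟨a, b⟩ := p
  have hd : HasFDerivAt (spherePatch c r) (fderiv ℝ (spherePatch c r) (a, b)) (a, b) :=
    ((contDiff_spherePatch c r).differentiable (by simp) _).hasFDerivAt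
  have hlin (k x : ℝ) : HasDerivAt (fun t => k * t) k x := by
    simpa using (hasDerivAt_id x).const_mul k
  have h1 : fderiv ℝ (spherePatch c r) (a, b) (1, 0) =
      (r * Real.pi) • ![Real.cos (Real.pi * a) * Real.cos (2 * Real.pi * b),
        Real.cos (Real.pi * a) * Real.sin (2 * Real.pi * b), -Real.sin (Real.pi * a)] := by
    refine (hd.comp_hasDerivAt a ((hasDerivAt_id a).prodMk (hasDerivAt_const a b))).unique ?_
    refine hasDerivAt_pi.2 fun i => ?_
    have hs := (hlin Real.pi a).sin
    have hc := (hlin Real.pi a).cos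
    fin_cases i
    · simpa [spherePatch, sphereCoord, Function.comp_def, mul_assoc, mul_left_comm, mul_comm] using
        ((hs.mul_const (Real.cos (2 * Real.pi * b))).const_mul r).const_add (c 0)
    · simpa [spherePatch, sphereCoord, Function.comp_def, mul_assoc, mul_left_comm, mul_comm] using
        ((hs.mul_const (Real.sin (2 * Real.pi * b))).const_mul r).const_add (c 1)
    · simpa [spherePatch, sphereCoord, Function.comp_def, mul_assoc, mul_left_comm, mul_comm] using
        (hc.const_mul r).const_add (c 2)
  have h2 : fderiv ℝ (spherePatch c r) (a, b) (0, 1) =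
      (r * (2 * Real.pi)) • ![-(Real.sin (Real.pi * a) * Real.sin (2 * Real.pi * b)),
        Real.sin (Real.pi * a) * Real.cos (2 * Real.pi * b), 0] := by
    refine (hd.comp_hasDerivAt b ((hasDerivAt_const b a).prodMk (hasDerivAt_id b))).unique ?_
    refine hasDerivAt_pi.2 fun i => ?_
    have hs := (hlin (2 * Real.pi) b).sin
    have hc := (hlin (2 * Real.pi) b).cos
    fin_cases i
    · simpa [spherePatch, sphereCoord, Function.comp_def, mul_assoc, mul_left_comm, mul_comm] using
        ((hc.const_mul (Real.sin (Real.pi * a))).const_mul r).const_add (c 0)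
    · simpa [spherePatch, sphereCoord, Function.comp_def, mul_assoc, mul_left_comm, mul_comm] using
        ((hs.const_mul (Real.sin (Real.pi * a))).const_mul r).const_add (c 1)
    · simpa [spherePatch, sphereCoord, Function.comp_def] using
        hasDerivAt_const b (c 2 + r * Real.cos (Real.pi * a))
  rw [patchNormal, h1, h2]
  have hsq := Real.sin_sq_add_cos_sq (2 * Real.pi * b)
  ext i
  fin_cases i <;> simp [cross_apply, sphereCoord]
  · ring
  · ring
  · linear_combination (2 * r ^ 2 * Real.pi ^ 2 * Real.sin (Real.pi * a) * Real.cos (Real.pi * a)) *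
      hsq

/-- The height determines the latitude. Away from the poles the sine factor cancels, so the
longitudes agree up to a full turn, and they differ by less than one turn because one of them is
interior. -/
theorem sphereCoord_injOn {p q : ℝ × ℝ} (hp : p ∈ openSquare) (hq : q ∈ closedSquare)
    (h : sphereCoord p = sphereCoord q) : p = q := by
  obtain ⟨a, b⟩ := p
  obtain ⟨a', b'⟩ := q
  obtain ⟨⟨ha0, ha1⟩, hb0, hb1⟩ := hp
  obtain ⟨⟨ha0', ha1'⟩, hb0', hb1'⟩ := hq
  simp only at ha0 ha1 hb0 hb1 ha0' ha1' hb0' hb1'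
  have hπ := Real.pi_pos
  have h0 := congrFun h 0
  have h1 := congrFun h 1
  have h2 := congrFun h 2
  simp only [sphereCoord, Matrix.cons_val_zero, Matrix.cons_val_one, Matrix.cons_val] at h0 h1 h2
  have ha : Real.pi * a = Real.pi * a' := Real.injOn_cos
    ⟨by positivity, by nlinarith⟩ ⟨by positivity, by nlinarith⟩ h2
  obtain rfl : a = a' := mul_left_cancel₀ hπ.ne' ha
  have hs : Real.sin (Real.pi * a) ≠ 0 :=
    (Real.sin_pos_of_pos_of_lt_pi (by positivity) (by nlinarith)).ne'
  have hc' := mul_left_cancel₀ hs h0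
  have hs' := mul_left_cancel₀ hs h1
  have hcos : Real.cos (2 * Real.pi * b - 2 * Real.pi * b') = 1 := by
    rw [Real.cos_sub, hc', hs', ← sq, ← sq, Real.cos_sq_add_sin_sq]
  have := (Real.cos_eq_one_iff_of_lt_of_lt (by nlinarith) (by nlinarith)).1 hcos
  have hb : 2 * Real.pi * b = 2 * Real.pi * b' := sub_eq_zero.1 this
  rw [mul_left_cancel₀ (by positivity) hb]

theorem exists_cos_sin_eq {x y : ℝ} (h : x ^ 2 + y ^ 2 = 1) :
    ∃ b ∈ Icc (0 : ℝ) 1, Real.cos (2 * Real.pi * b) = x ∧ Real.sin (2 * Real.pi * b) = y := by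
  have hπ := Real.pi_pos
  have hn : ‖(⟨x, y⟩ : ℂ)‖ = 1 := by
    rw [← sq_eq_sq₀ (norm_nonneg _) zero_le_one, Complex.sq_norm, Complex.normSq_apply]
    simp only
    linarith
  have h0 : (⟨x, y⟩ : ℂ) ≠ 0 := norm_pos_iff.1 (hn ▸ one_pos)
  have hc := Complex.cos_arg h0
  have hs := Complex.sin_arg (⟨x, y⟩ : ℂ)
  rw [hn, div_one] at hc hs
  have h1 := Complex.neg_pi_lt_arg (⟨x, y⟩ : ℂ)
  have h2 := Complex.arg_le_pi (⟨x, y⟩ : ℂ)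
  set θ := Complex.arg ⟨x, y⟩
  rcases le_or_gt 0 θ with h3 | h3
  · refine ⟨θ / (2 * Real.pi), ⟨by positivity, (div_le_one (by positivity)).2 (by linarith)⟩, ?_⟩
    rw [mul_div_cancel₀ _ (by positivity)]
    exact ⟨hc, hs⟩
  · refine ⟨(θ + 2 * Real.pi) / (2 * Real.pi),
      ⟨div_nonneg (by linarith) (by positivity), (div_le_one (by positivity)).2 (by linarith)⟩, ?_⟩
    rw [mul_div_cancel₀ _ (by positivity), Real.cos_add_two_pi, Real.sin_add_two_pi]
    exact ⟨hc, hs⟩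

theorem sphereCoord_image :
    sphereCoord '' closedSquare = {n | n 0 ^ 2 + n 1 ^ 2 + n 2 ^ 2 = 1} := by
  have hπ := Real.pi_pos
  ext n
  constructor
  · rintro ⟨⟨a, b⟩, -, rfl⟩
    have h1 := Real.sin_sq_add_cos_sq (Real.pi * a)
    have h2 := Real.sin_sq_add_cos_sq (2 * Real.pi * b)
    simp only [sphereCoord, mem_ofPred_eq, Matrix.cons_val_zero, Matrix.cons_val_one,
      Matrix.cons_val]
    linear_combination h1 + Real.sin (Real.pi * a) ^ 2 * h2
  · intro hn
    rw [mem_ofPred_eq] at hn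
    have hle : -1 ≤ n 2 ∧ n 2 ≤ 1 := by constructor <;> nlinarith [sq_nonneg (n 0), sq_nonneg (n 1)]
    have hcos : Real.cos (Real.arccos (n 2)) = n 2 := Real.cos_arccos hle.1 hle.2
    have hsq := Real.sin_sq_add_cos_sq (Real.arccos (n 2))
    rw [hcos] at hsq
    have hb : ∃ b ∈ Icc (0 : ℝ) 1,
        Real.sin (Real.arccos (n 2)) * Real.cos (2 * Real.pi * b) = n 0 ∧
        Real.sin (Real.arccos (n 2)) * Real.sin (2 * Real.pi * b) = n 1 := by
      -- At the poles every longitude works, and `0` is chosen.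
      rcases eq_or_ne (Real.sin (Real.arccos (n 2))) 0 with h0 | h0
      · rw [h0] at hsq ⊢
        have h01 : n 0 = 0 := by nlinarith [sq_nonneg (n 0), sq_nonneg (n 1)]
        have h02 : n 1 = 0 := by nlinarith [sq_nonneg (n 0), sq_nonneg (n 1)]
        exact ⟨0, by simp, by simp [h01], by simp [h02]⟩
      · obtain ⟨b, hb, hc, hs⟩ := exists_cos_sin_eq (x := n 0 / Real.sin (Real.arccos (n 2)))
          (y := n 1 / Real.sin (Real.arccos (n 2))) (by field_simp; linarith)
        exact ⟨b, hb, by rw [hc, mul_div_cancel₀ _ h0], by rw [hs, mul_div_cancel₀ _ h0]⟩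
    obtain ⟨b, hb, h0, h1⟩ := hb
    refine ⟨(Real.arccos (n 2) / Real.pi, b), ⟨⟨by positivity [Real.arccos_nonneg (n 2)],
      (div_le_one hπ).2 (Real.arccos_le_pi _)⟩, hb⟩, ?_⟩
    have hmul : Real.pi * (Real.arccos (n 2) / Real.pi) = Real.arccos (n 2) :=
      mul_div_cancel₀ _ hπ.ne'
    ext i
    fin_cases i <;> simp [sphereCoord, hmul, h0, h1, hcos]

theorem closedSquare_isConnected : IsConnected closedSquare :=
  (isConnected_Icc zero_le_one).prod (isConnected_Icc zero_le_one)

/-- An affine homeomorphism onto the Euclidean unit sphere transports the standard charts. -/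
theorem nonempty_chartedSpace_sphere (c : Fin 3 → ℝ) {r : ℝ} (hr : r ≠ 0) :
    Nonempty (ChartedSpace (EuclideanSpace ℝ (Fin 2))
      (patchUnion fun _ : Fin 1 => spherePatch c r)) := by
  let e : (Fin 3 → ℝ) ≃ₜ EuclideanSpace ℝ (Fin 3) :=
    ((Homeomorph.subRight c).trans (Homeomorph.smulOfNeZero r⁻¹ (inv_ne_zero hr))).trans
      (EuclideanSpace.equiv (Fin 3) ℝ).symm.toHomeomorph
  have he (x) : x ∈ patchUnion (fun _ : Fin 1 => spherePatch c r) ↔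
      e x ∈ Metric.sphere (0 : EuclideanSpace ℝ (Fin 3)) 1 := by
    have h1 : x ∈ patchUnion (fun _ : Fin 1 => spherePatch c r) ↔
        r⁻¹ • (x - c) ∈ sphereCoord '' closedSquare := by
      simp only [patchUnion, mem_iUnion, exists_const, mem_image]
      refine exists_congr fun p => and_congr_right fun _ => ?_
      rw [spherePatch, eq_inv_smul_iff₀ hr, eq_sub_iff_add_eq, add_comm]
    rw [h1, sphereCoord_image, mem_sphere_zero_iff_norm, EuclideanSpace.norm_eq,
      Real.sqrt_eq_one, Fin.sum_univ_three]
    simp only [Real.norm_eq_abs, sq_abs]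
    rfl
  let e' := e.subtype he
  have : Fact (Module.finrank ℝ (EuclideanSpace ℝ (Fin 3)) = 2 + 1) := ⟨by simp⟩
  have : Nonempty (patchUnion fun _ : Fin 1 => spherePatch c r) :=
    ⟨⟨spherePatch c r (0, 0), mem_iUnion.2 ⟨0, mem_image_of_mem _ (by simp [closedSquare])⟩⟩⟩
  have := e'.isOpenEmbedding.singletonChartedSpace
  exact ⟨ChartedSpace.comp _ (Metric.sphere (0 : EuclideanSpace ℝ (Fin 3)) 1) _⟩

/-- The sphere with centre `c` and radius `r` as a closed surface. -/
def sphereSurface (c : Fin 3 → ℝ) (r : ℝ) (hr : r ≠ 0) : ClosedSurface where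
  n := 1
  patch _ := spherePatch c r
  smooth _ := contDiff_spherePatch c r
  inj k l p hp q hq h :=
    ⟨Subsingleton.elim _ _, sphereCoord_injOn hp hq
      (smul_right_injective _ hr (add_left_cancel h))⟩
  immersive _ p hp := by
    have hπ := Real.pi_pos
    have hs : Real.sin (Real.pi * p.1) ≠ 0 :=
      (Real.sin_pos_of_pos_of_lt_pi (mul_pos hπ hp.1.1) (by nlinarith [hp.1.2])).ne'
    have h0 : sphereCoord p ≠ 0 := by
      intro h
      have := sphereCoord_image.subset (mem_image_of_mem sphereCoord
        (prod_mono Ioo_subset_Icc_self Ioo_subset_Icc_self hp))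
      simp [h] at this
    rw [patchNormal_spherePatch]
    exact smul_ne_zero (mul_ne_zero (pow_ne_zero 2 hr) (by positivity)) h0
  -- Edges `0` and `2` are the same meridian in opposite directions; edges `1` and `3` collapse to
  -- the poles.
  glue e := (e.1, e.2 + 2)
  edges := by
    rintro ⟨k, j⟩
    fin_cases j
    · right
      refine ⟨by simp, by simp, fun s _ => ?_⟩
      simp [spherePatch, sphereCoord, squareEdge]
    · left
      refine ⟨spherePatch c r (1, 0), fun s _ => ?_⟩
      simp [spherePatch, sphereCoord, squareEdge]
    · right
      refine ⟨by simp, by simp, fun s _ => ?_⟩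
      simp [spherePatch, sphereCoord, squareEdge]
    · left
      refine ⟨spherePatch c r (0, 0), fun s _ => ?_⟩
      simp [spherePatch, sphereCoord, squareEdge]
  connected := by
    rw [patchUnion, iUnion_const]
    exact closedSquare_isConnected.image _ (contDiff_spherePatch c r).continuous.continuousOn
  manifold := nonempty_chartedSpace_sphere c hr

/-! ### The flux through small spheres -/

/-- Over a full period the squares have mean `1 / 2` and all other trigonometric terms have mean
zero. -/
theorem integral_longitude (P Q R S T U : ℝ) :
    ∫ b in Icc (0 : ℝ) 1, (P * Real.cos (2 * Real.pi * b) ^ 2 + Q * Real.sin (2 * Real.pi * b) ^ 2 +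
      R * (Real.sin (2 * Real.pi * b) * Real.cos (2 * Real.pi * b)) +
      S * Real.cos (2 * Real.pi * b) + T * Real.sin (2 * Real.pi * b) + U) = (P + Q) / 2 + U := by
  have hπ := Real.pi_ne_zero
  have hd (b : ℝ) : HasDerivAt (fun b => (P + Q) / 2 * b + (P - Q) / (4 * Real.pi) *
      (Real.sin (2 * Real.pi * b) * Real.cos (2 * Real.pi * b)) +
      R / (4 * Real.pi) * Real.sin (2 * Real.pi * b) ^ 2 +
      S / (2 * Real.pi) * Real.sin (2 * Real.pi * b) -
      T / (2 * Real.pi) * Real.cos (2 * Real.pi * b) + U * b)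
      (P * Real.cos (2 * Real.pi * b) ^ 2 + Q * Real.sin (2 * Real.pi * b) ^ 2 +
      R * (Real.sin (2 * Real.pi * b) * Real.cos (2 * Real.pi * b)) +
      S * Real.cos (2 * Real.pi * b) + T * Real.sin (2 * Real.pi * b) + U) b := by
    have hlin (k : ℝ) : HasDerivAt (fun t => k * t) k b := by
      simpa using (hasDerivAt_id b).const_mul k
    have hs := (hlin (2 * Real.pi)).sin
    have hc := (hlin (2 * Real.pi)).cos
    have := ((((((hlin ((P + Q) / 2)).add ((hs.mul hc).const_mul ((P - Q) / (4 * Real.pi)))).add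
      ((hs.pow 2).const_mul (R / (4 * Real.pi)))).add (hs.const_mul (S / (2 * Real.pi)))).sub
      (hc.const_mul (T / (2 * Real.pi)))).add (hlin U))
    refine this.congr_deriv ?_
    have hsq := Real.sin_sq_add_cos_sq (2 * Real.pi * b)
    field_simp
    push_cast
    linear_combination (-4 * (P + Q)) * hsq
  rw [integral_Icc_eq_integral_Ioc, ← intervalIntegral.integral_of_le zero_le_one,
    intervalIntegral.integral_eq_sub_of_hasDerivAt (fun b _ => hd b)
      (Continuous.intervalIntegrable (by fun_prop) _ _)]
  simp
  ring

theorem integral_latitude (K L : ℝ) :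
    ∫ a in Icc (0 : ℝ) 1, (K * Real.sin (Real.pi * a) ^ 3 +
      L * (Real.cos (Real.pi * a) ^ 2 * Real.sin (Real.pi * a))) =
      (4 * K + 2 * L) / (3 * Real.pi) := by
  have hπ := Real.pi_ne_zero
  have hd (a : ℝ) : HasDerivAt (fun a => (K - L) / (3 * Real.pi) * Real.cos (Real.pi * a) ^ 3 -
      K / Real.pi * Real.cos (Real.pi * a)) (K * Real.sin (Real.pi * a) ^ 3 +
      L * (Real.cos (Real.pi * a) ^ 2 * Real.sin (Real.pi * a))) a := by
    have hc := (HasDerivAt.const_mul Real.pi (hasDerivAt_id a)).cos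
    have := ((hc.pow 3).const_mul ((K - L) / (3 * Real.pi))).sub (hc.const_mul (K / Real.pi))
    refine this.congr_deriv ?_
    have hsq := Real.sin_sq_add_cos_sq (Real.pi * a)
    simp only [id]
    field_simp
    push_cast
    linear_combination (-3 * K * Real.sin (Real.pi * a)) * hsq
  rw [integral_Icc_eq_integral_Ioc, ← intervalIntegral.integral_of_le zero_le_one,
    intervalIntegral.integral_eq_sub_of_hasDerivAt (fun a _ => hd a)
      (Continuous.intervalIntegrable (by fun_prop) _ _)]
  simp
  field_simp
  ring

/-- The flux of a linear vector field through the unit sphere. -/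
theorem integral_sphere_linear (T : (Fin 3 → ℝ) →L[ℝ] Fin 3 → ℝ) :
    ∫ p in closedSquare, T (sphereCoord p) ⬝ᵥ
        ((2 * Real.pi ^ 2 * Real.sin (Real.pi * p.1)) • sphereCoord p) =
      4 * Real.pi / 3 * ∑ i, T (Pi.single i 1) i := by
  have hcont : Continuous fun p : ℝ × ℝ => T (sphereCoord p) ⬝ᵥ
      ((2 * Real.pi ^ 2 * Real.sin (Real.pi * p.1)) • sphereCoord p) := by
    have := contDiff_sphereCoord.continuous
    exact Continuous.dotProduct (by fun_prop) (by fun_prop)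
  have hsq := hcont.continuousOn.integrableOn_compact (μ := (volume : Measure (ℝ × ℝ)))
    ((isCompact_Icc (a := (0 : ℝ)) (b := 1)).prod (isCompact_Icc (a := (0 : ℝ)) (b := 1)))
  rw [closedSquare, Measure.volume_eq_prod, setIntegral_prod _ hsq]
  have hin (a : ℝ) : (∫ b in Icc (0 : ℝ) 1, T (sphereCoord (a, b)) ⬝ᵥ
      ((2 * Real.pi ^ 2 * Real.sin (Real.pi * a)) • sphereCoord (a, b))) =
      (Real.pi ^ 2 * (T (Pi.single 0 1) 0 + T (Pi.single 1 1) 1)) * Real.sin (Real.pi * a) ^ 3 +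
      (2 * Real.pi ^ 2 * T (Pi.single 2 1) 2) *
        (Real.cos (Real.pi * a) ^ 2 * Real.sin (Real.pi * a)) := by
    obtain ⟨s, hs⟩ : ∃ s, Real.sin (Real.pi * a) = s := ⟨_, rfl⟩
    obtain ⟨c, hc⟩ : ∃ c, Real.cos (Real.pi * a) = c := ⟨_, rfl⟩
    rw [hs, hc]
    -- The coefficients come from expanding `T n · n` at `n = (s cos, s sin, c)` and multiplying by
    -- `2π²s`.
    have := integral_longitude (2 * Real.pi ^ 2 * s ^ 3 * T (Pi.single 0 1) 0)
      (2 * Real.pi ^ 2 * s ^ 3 * T (Pi.single 1 1) 1)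
      (2 * Real.pi ^ 2 * s ^ 3 * (T (Pi.single 0 1) 1 + T (Pi.single 1 1) 0))
      (2 * Real.pi ^ 2 * s ^ 2 * c * (T (Pi.single 0 1) 2 + T (Pi.single 2 1) 0))
      (2 * Real.pi ^ 2 * s ^ 2 * c * (T (Pi.single 1 1) 2 + T (Pi.single 2 1) 1))
      (2 * Real.pi ^ 2 * (c ^ 2 * s) * T (Pi.single 2 1) 2)
    refine Eq.trans (integral_congr_ae (Filter.Eventually.of_forall fun b => ?_))
      (this.trans (by ring))
    simp only [dotProduct, Fin.sum_univ_three, map_apply_eq_sum_single T (sphereCoord (a, b))]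
    simp only [sphereCoord, hs, hc, Pi.smul_apply, smul_eq_mul, Matrix.cons_val_zero, Matrix.cons_val_one, Matrix.cons_val]
    ring
  simp only [hin]
  rw [integral_latitude, Fin.sum_univ_three]
  have hπ := Real.pi_ne_zero
  field_simp
  ring

/-- A smooth vector field without flux through spheres is divergence-free. -/
theorem sum_fderiv_eq_zero_of_flux_eq_zero {F : (Fin 3 → ℝ) → Fin 3 → ℝ} (hF : ContDiff ℝ ∞ F)
    (h : ∀ S : ClosedSurface, S.flux F = 0) (c : Fin 3 → ℝ) :
    ∑ i, fderiv ℝ F c (Pi.single i 1) i = 0 := by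
  -- The flux density with the factor `r ^ 2` of the normal removed, which makes sense and is smooth
  -- also at `r = 0`.
  let g : ℝ × (ℝ × ℝ) → ℝ := fun q => F (spherePatch c q.1 q.2) ⬝ᵥ
    ((2 * Real.pi ^ 2 * Real.sin (Real.pi * q.2.1)) • sphereCoord q.2)
  have hn : ContDiff ℝ ∞ fun q : ℝ × (ℝ × ℝ) => sphereCoord q.2 :=
    contDiff_sphereCoord.comp contDiff_snd
  have hpatch : ContDiff ℝ ∞ fun q : ℝ × (ℝ × ℝ) => spherePatch c q.1 q.2 :=
    contDiff_const.add (contDiff_fst.smul hn)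
  have hg : ContDiff ℝ ∞ g := contDiff_dotProduct (hF.comp hpatch)
    (ContDiff.smul (f := fun q : ℝ × (ℝ × ℝ) => 2 * Real.pi ^ 2 * Real.sin (Real.pi * q.2.1))
      (by fun_prop) hn)
  have hK : IsCompact closedSquare := isCompact_Icc.prod isCompact_Icc
  let J : ℝ → ℝ := fun r => ∫ p in closedSquare, g (r, p)
  have hJ : ContDiff ℝ ∞ J := contDiff_setIntegral hK hg
  have hJ0 : EqOn J 0 (Ioi 0) := by
    intro r hr
    have hr' : r ≠ 0 := (mem_Ioi.1 hr).ne'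
    have h1 := h (sphereSurface c r hr')
    have h2 : (sphereSurface c r hr').flux F = r ^ 2 * J r := by
      refine (Fin.sum_univ_one _).trans ?_
      rw [← integral_const_mul]
      congr 1
      funext p
      change F (spherePatch c r p) ⬝ᵥ patchNormal (spherePatch c r) p = _
      rw [patchNormal_spherePatch, mul_smul, dotProduct_smul]
      rfl
    rw [h2] at h1
    exact (mul_eq_zero.1 h1).resolve_left (pow_ne_zero 2 hr')
  -- By continuity `J` vanishes also at `0`, so its derivative there can be computed from the right
  -- and is zero.
  have hJ1 : EqOn J 0 (Ici 0) := by
    rw [← closure_Ioi]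
    exact hJ0.closure hJ.continuous continuous_const
  have hd := (hJ.differentiable (by simp) 0).hasDerivAt
  have hd0 : deriv J 0 = 0 :=
    (uniqueDiffOn_Ici (0 : ℝ) 0 self_mem_Ici).eq_deriv _ hd.hasDerivWithinAt
      ((hasDerivWithinAt_const (0 : ℝ) (Ici 0) (0 : ℝ)).congr hJ1 (hJ1 self_mem_Ici))
  -- Differentiating at `r = 0` replaces `F` by its linearization at `c`, whose flux through the
  -- unit sphere is the trace times the volume of the ball.
  have hd1 : deriv J 0 = 4 * Real.pi / 3 * ∑ i, fderiv ℝ F c (Pi.single i 1) i := by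
    rw [← integral_sphere_linear, ← fderiv_apply_one_eq_deriv,
      fderiv_setIntegral_apply hK (hg.of_le (mod_cast le_top))]
    congr 1
    funext p
    have h1 : HasDerivAt (fun r : ℝ => ((r, p) : ℝ × (ℝ × ℝ))) (1, 0) 0 :=
      (hasDerivAt_id 0).prodMk (hasDerivAt_const 0 p)
    have h2 := ((hg.differentiable (by simp) (0, p)).hasFDerivAt).comp_hasDerivAt (0 : ℝ) h1
    have h3 : HasDerivAt (fun r : ℝ => spherePatch c r p) (sphereCoord p) 0 := by
      simpa [spherePatch] using ((hasDerivAt_id (0 : ℝ)).smul_const (sphereCoord p)).const_add c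
    have hF0 : HasFDerivAt F (fderiv ℝ F c) (spherePatch c 0 p) := by
      rw [spherePatch, zero_smul, add_zero]
      exact (hF.differentiable (by simp) c).hasFDerivAt
    have h4 := hF0.comp_hasDerivAt (0 : ℝ) h3
    have h5 := HasDerivAt.fun_sum (u := Finset.univ) fun i _ => (hasDerivAt_pi.1 h4 i).mul_const
      (((2 * Real.pi ^ 2 * Real.sin (Real.pi * p.1)) • sphereCoord p) i)
    exact h2.unique h5
  rw [hd0] at hd1
  exact (mul_eq_zero.1 hd1.symm).resolve_left (by positivity)

/-! ### Identically vanishing fluxes -/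

theorem IsDifferentialFunction.totalDeriv {f : JetSpace m → ℝ} (hf : IsDifferentialFunction f)
    (i : Fin 4) : IsDifferentialFunction (totalDeriv i f) :=
  hf.lineDeriv (isDifferentialField_totalField i)

theorem isDifferentialFunction_totalCurl {Θ : Fin 3 → JetSpace m → ℝ}
    (hΘ : ∀ i, IsDifferentialFunction (Θ i)) (i : Fin 3) :
    IsDifferentialFunction (totalCurl Θ i) := by
  have h (j k : Fin 4) (a b : Fin 3) : IsDifferentialFunction fun p =>
      TopFlux.totalDeriv j (Θ a) p - TopFlux.totalDeriv k (Θ b) p :=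
    (diffAlg m).sub_mem ((hΘ a).totalDeriv j) ((hΘ b).totalDeriv k)
  fin_cases i
  · exact h 2 3 2 1
  · exact h 3 1 0 2
  · exact h 1 2 1 0

/-- The flux of a total curl vanishes identically. -/
theorem flux_totalCurl {Θ : Fin 3 → JetSpace m → ℝ} (hΘ : ∀ i, IsDifferentialFunction (Θ i))
    {u : (Fin 4 → ℝ) → Fin m → ℝ} (hu : ContDiff ℝ ∞ u) (t : ℝ) (S : ClosedSurface) :
    S.flux (fieldAt (totalCurl Θ) u t) = 0 := by
  rw [fieldAt_totalCurl hΘ hu]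
  exact S.flux_curl (contDiff_fieldAt hΘ hu t)

/-- A vector differential function whose flux vanishes identically is a total curl. -/
theorem exists_totalCurl_of_flux_eq_zero {Y : Fin 3 → JetSpace m → ℝ}
    (hY : ∀ i, IsDifferentialFunction (Y i))
    (h : ∀ u : (Fin 4 → ℝ) → Fin m → ℝ, ContDiff ℝ ∞ u →
      ∀ (t : ℝ) (S : ClosedSurface), S.flux (fieldAt Y u t) = 0) :
    ∃ Θ : Fin 3 → JetSpace m → ℝ, (∀ i, IsDifferentialFunction (Θ i)) ∧ Y = totalCurl Θ := by
  let f : Fin 3 → DiffFun m := fun i => .mk (Y i) (hY i)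
  have hdiv : totalD 1 (f 0) + totalD 2 (f 1) + totalD 3 (f 2) = 0 := by
    refine DiffFun.ext fun p => DiffFun.isDifferentialFunction _ |>.eq_zero_of_comp_jet
      (fun u hu z => ?_) p
    have h1 := sum_fderiv_eq_zero_of_flux_eq_zero (contDiff_fieldAt hY hu (z 0)) (h u hu (z 0))
      (Fin.tail z)
    simp only [fderiv_fieldAt hY hu, Fin.cons_self_tail, Fin.sum_univ_three] at h1
    exact h1
  obtain ⟨θ₁, θ₂, θ₃, e₁, e₂, e₃⟩ := exists_totalD_curl hdiv
  let θ : Fin 3 → DiffFun m := ![θ₁, θ₂, θ₃]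
  refine ⟨fun i => θ i, fun i => (θ i).isDifferentialFunction, ?_⟩
  funext i p
  fin_cases i
  · exact congrArg (fun f : DiffFun m => f p) e₁
  · exact congrArg (fun f : DiffFun m => f p) e₂
  · exact congrArg (fun f : DiffFun m => f p) e₃

end TopFlux

end

/-! ### The equivalence of global and local triviality. -/

theorem mainTheorem12 (m M : ℕ)
    (G : Fin M → TopFlux.JetSpace m → ℝ) (hG : ∀ a, TopFlux.IsDifferentialFunction (G a))
    (X : Fin 3 → TopFlux.JetSpace m → ℝ) (hX : ∀ i, TopFlux.IsDifferentialFunction (X i))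
    (hlaw : TopFlux.IsTopologicalFluxLaw G X) :
    TopFlux.GloballyTrivial G X ↔ TopFlux.LocallyTrivial G X := by
  constructor
  · rintro ⟨Y, hY, hXY, hflux⟩
    -- The representative `Y` is a total curl on all of jet space, so its agreement with `X` on
    -- solutions is already local triviality.
    obtain ⟨Θ, hΘ, rfl⟩ := TopFlux.exists_totalCurl_of_flux_eq_zero hY hflux
    exact ⟨Θ, hΘ, hXY⟩
  · rintro ⟨Θ, hΘ, hX⟩
    exact ⟨TopFlux.totalCurl Θ, TopFlux.isDifferentialFunction_totalCurl hΘ, hX,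
      fun _ hu t S => TopFlux.flux_totalCurl hΘ hu t S⟩
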